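/- **Setting.** For $m=1,2,\dots$ let $n=n_m\to\infty$ and $p=p_m\to\infty$ be a sample size and a number of binary responses, and let $K=K_m$ be a number of covariate matrices; all objects below depend on $m$. Let $W_1,\dots,W_K$ be symmetric real $p\times p$ matrices with zero diagonal, $W_k=(w^{(k)}_{jj'})$, and let $\alpha^{(0)}\in\mathbb R^K$ have support $S=\{k:\alpha^{(0)}_k\ne0\}$, $S^c=\{1,\dots,K\}\setminus S$, whose cardinality $K_0=|S|$ stays bounded as $m\to\infty$. The observations $y_1,\dots,y_n\in\{0,1\}^p$ are i.i.d. from the Ising similarity regression model without main effects, $$P(y_i=u)\;\propto\;\exp\Big\{\sum_{1\le j<j'\le p}\Big(\sum_{k=1}^K\alpha^{(0)}_k w^{(k)}_{jj'}\Big)u_ju_{j'}\Big\},\qquad u\in\{0,1\}^p .$$ Let $\mathcal X^{(i)}$ be the $p\times K$ matrix with entries $\mathcal X^{(i)}_{jk}=\sum_{j'}w^{(k)}_{jj'}y_{ij'}$, and let $$l(\alpha)=\frac1{np}\sum_{i=1}^n\sum_{j=1}^p\Big[y_{ij}(\mathcal X^{(i)}\alpha)_j-\log\{1+\exp((\mathcal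 X^{(i)}\alpha)_j)\}\Big]$$ be the normalized log pseudo-likelihood. Let $\bar\alpha=\arg\min_\alpha\{-l(\alpha)\}$, and for a tuning parameter $\lambda>0$ let $$\hat\alpha=\arg\min_\alpha\Big\{-l(\alpha)+\lambda\sum_{k=1}^K\frac{|\alpha_k|}{|\bar\alpha_k|}\Big\}$$ be the adaptive-lasso regularized pseudo-likelihood estimator (if $\bar\alpha_k=0$ the weight $1/|\bar\alpha_k|$ is $\infty$, with $\infty\cdot0=0$, so $\hat\alpha_k=0$). Put $U^0=E\{\frac1{np}\sum_{i}\mathcal X^{(i)\top}\mathcal X^{(i)}\}$ and $M^0=E\{-\nabla^2l(\alpha^{(0)})\}$. **Conditions.** There are constants $C_{\min},C_{\max},C_W>0$ and $C_M\in(0,1)$, not depending on $m$, such that for all large $m$: 1. the smallest eigenvalue of $M^0$ is at least $C_{\min}$ and the largest eigenvalue of $U^0$ is at most $C_{\max}$; 2. every $W_k$ has maximal absolute column sum at most $C_W$; 3. the maximal absolute row sum of $M^0_{S^c,S}(M^0_{S,S})^{-1}$ is at most $1-C_M$; and as $m\to\infty$ 4. $\lambda\sqrt n/\{\min_{k\in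 S}|\alpha^{(0)}_k|\sqrt{\log p}\}\to0$ (this quotient is read as $0$ if $S=\emptyset$) and $\lambda n/\{\sqrt K\log p\}\to\infty$. **Theorem 2.** Assume Conditions 1–4, that $K\sqrt{\log(p)/n}\to0$, and that $K=o\big(p^{C_\nabla^2/(8C_W^2)}\big)$ for some finite constant $C_\nabla>0$. Let $M$ be any constant with $M>4/C_{\min}$. Then, with probability tending to one, the minimizers $\bar\alpha$ and $\hat\alpha$ exist and are unique, and (a) $\|\hat\alpha-\alpha^{(0)}\|_2\le M\sqrt{K_0\log(p)/n}$; (b) $\hat\alpha_k\neq0$ for all $k\in S$ and $\hat\alpha_k=0$ for all $k\in S^c$. -/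

import Mathlib

open Filter Topology MeasureTheory Asymptotics
open scoped ENNReal

noncomputable section

namespace IsingSim

/-- A binary response vector in `{0,1}^p`; `true` codes `1` and `false` codes `0`. -/
abbrev Config (p : ℕ) := Fin p → Bool

/-- The numerical value of a binary response. -/
def val (b : Bool) : ℝ := if b then 1 else 0

variable {n p K : ℕ}

/-! ### The Ising similarity regression model without main effects -/

/-- The interaction coefficient `θ_{jj'} = ∑ k, α_k w_{jj'}^{(k)}`. -/
def interaction (W : Fin K → Matrix (Fin p) (Fin p) ℝ) (α : EuclideanSpace ℝ (Fin K))
    (j j' : Fin p) : ℝ :=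
  ∑ k, α k * W k j j'

/-- The exponent `∑_{j < j'} θ_{jj'} u_j u_{j'}` of the Ising probability mass function. -/
def exponent (W : Fin K → Matrix (Fin p) (Fin p) ℝ) (α : EuclideanSpace ℝ (Fin K))
    (u : Config p) : ℝ :=
  ∑ j, ∑ j' ∈ Finset.Ioi j, interaction W α j j' * val (u j) * val (u j')

/-- The partition function. -/
def partitionFunction (W : Fin K → Matrix (Fin p) (Fin p) ℝ)
    (α : EuclideanSpace ℝ (Fin K)) : ℝ :=
  ∑ u : Config p, Real.exp (exponent W α u)

theorem partitionFunction_pos (W : Fin K → Matrix (Fin p) (Fin p) ℝ)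
    (α : EuclideanSpace ℝ (Fin K)) : 0 < partitionFunction W α :=
  Finset.sum_pos (fun _ _ => Real.exp_pos _) Finset.univ_nonempty

/-- The Ising probability mass function on `{0,1}^p`. -/
def isingPMF (W : Fin K → Matrix (Fin p) (Fin p) ℝ) (α : EuclideanSpace ℝ (Fin K)) :
    PMF (Config p) :=
  PMF.ofFintype
    (fun u => ENNReal.ofReal (Real.exp (exponent W α u) / partitionFunction W α))
    (by
      have h := partitionFunction_pos W α
      rw [← ENNReal.ofReal_sum_of_nonneg
        (fun u _ => div_nonneg (Real.exp_pos _).le h.le), ← Finset.sum_div]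
      change ENNReal.ofReal (partitionFunction W α / partitionFunction W α) = 1
      rw [div_self h.ne', ENNReal.ofReal_one])

/-- The joint law of `n` i.i.d. response vectors `y_1, …, y_n` drawn from the Ising model. -/
def sampleLaw (n : ℕ) (W : Fin K → Matrix (Fin p) (Fin p) ℝ)
    (α : EuclideanSpace ℝ (Fin K)) : Measure (Fin n → Config p) :=
  Measure.pi fun _ => (isingPMF W α).toMeasure

/-! ### Pseudo-likelihood and the estimators -/

/-- The `p × K` design matrix of one response vector `u`: its `(j, k)` entry is
the inner product of the `j`-th row of `W_k` with `u`. -/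
def design (W : Fin K → Matrix (Fin p) (Fin p) ℝ) (u : Config p) :
    Matrix (Fin p) (Fin K) ℝ :=
  Matrix.of fun j k => ∑ j', W k j j' * val (u j')

/-- The log pseudo-likelihood `l_i(α)` of one response vector. -/
def logPLOne (W : Fin K → Matrix (Fin p) (Fin p) ℝ) (u : Config p)
    (α : EuclideanSpace ℝ (Fin K)) : ℝ :=
  ∑ j, (val (u j) * (∑ k, α k * design W u j k)
    - Real.log (1 + Real.exp (∑ k, α k * design W u j k)))

/-- The normalized log pseudo-likelihood `l(α) = (1 / (n p)) ∑ i, l_i(α)`. -/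
def logPL (W : Fin K → Matrix (Fin p) (Fin p) ℝ) (y : Fin n → Config p)
    (α : EuclideanSpace ℝ (Fin K)) : ℝ :=
  (∑ i, logPLOne W (y i) α) / ((n : ℝ) * (p : ℝ))

/-- `a` is the unique minimizer of `f`, that is, `a = argmin f`. -/
def IsArgmin {E R : Type*} [LT R] (f : E → R) (a : E) : Prop :=
  ∀ b, b ≠ a → f a < f b

/-- The adaptive weight `w_k = 1 / |ᾱ_k|` in `[0, ∞]`; it is `∞` when `ᾱ_k = 0`. -/
def adaptiveWeight (αbar : EuclideanSpace ℝ (Fin K)) (k : Fin K) : ℝ≥0∞ :=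
  (ENNReal.ofReal |αbar k|)⁻¹

/-- The adaptive lasso objective `-l(α) + λ ∑ k, w_k |α_k|`, with values in `(-∞, ∞]`.
In `ℝ≥0∞` one has `∞ * 0 = 0`, so a coefficient of infinite weight has to vanish for the
objective to be finite, and then costs nothing. -/
def adaptiveObjective (W : Fin K → Matrix (Fin p) (Fin p) ℝ) (y : Fin n → Config p)
    (lam : ℝ) (αbar α : EuclideanSpace ℝ (Fin K)) : EReal :=
  ((-logPL W y α : ℝ) : EReal) +
    ((ENNReal.ofReal lam * ∑ k, adaptiveWeight αbar k * ENNReal.ofReal |α k| : ℝ≥0∞) : EReal)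

/-! ### Population quantities -/

/-- The Hessian matrix of `f` at `α`. -/
def hessian (f : EuclideanSpace ℝ (Fin K) → ℝ) (α : EuclideanSpace ℝ (Fin K)) :
    Matrix (Fin K) (Fin K) ℝ :=
  Matrix.of fun k k' =>
    fderiv ℝ (fun a => fderiv ℝ f a (EuclideanSpace.single k' 1)) α (EuclideanSpace.single k 1)

/-- `U⁰ = E {∑ i, X_iᵀ X_i / (n p)}` under the model with coefficient vector `α`. -/
def matU (n : ℕ) (W : Fin K → Matrix (Fin p) (Fin p) ℝ) (α : EuclideanSpace ℝ (Fin K)) :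
    Matrix (Fin K) (Fin K) ℝ :=
  Matrix.of fun k k' =>
    ∫ y, (∑ i, ((design W (y i)).transpose * design W (y i)) k k') / ((n : ℝ) * (p : ℝ))
      ∂(sampleLaw n W α)

/-- `M⁰ = E {-∇² l(α)}` under the model with coefficient vector `α`. -/
def matM (n : ℕ) (W : Fin K → Matrix (Fin p) (Fin p) ℝ) (α : EuclideanSpace ℝ (Fin K)) :
    Matrix (Fin K) (Fin K) ℝ :=
  Matrix.of fun k k' => ∫ y, -(hessian (logPL W y) α k k') ∂(sampleLaw n W α)

/-- The support `S = {k : α_k ≠ 0}`. -/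
def supp (α : EuclideanSpace ℝ (Fin K)) : Finset (Fin K) :=
  Finset.univ.filter fun k => α k ≠ 0

/-- The smallest absolute nonzero coefficient `min {|α_k| : k ∈ S}`
(the value `0` if `S` is empty). -/
def minSignal (α : EuclideanSpace ℝ (Fin K)) : ℝ :=
  ⨅ k : {k // k ∈ supp α}, |α k.1|

/-- The matrix `H_{Sᶜ,S} (H_{S,S})⁻¹`. -/
def irrepMatrix (H : Matrix (Fin K) (Fin K) ℝ) (S : Finset (Fin K)) :
    Matrix {k // k ∉ S} {k // k ∈ S} ℝ :=
  H.submatrix Subtype.val Subtype.val *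
    (H.submatrix (Subtype.val : {k // k ∈ S} → Fin K) Subtype.val)⁻¹

/-! ### The four conditions, for one problem size -/

/-- `Λ_min(M⁰) ≥ C_min` and `Λ_max(U⁰) ≤ C_max` (the elements of the real spectrum are the
eigenvalues). -/
def EigenCond (n : ℕ) (W : Fin K → Matrix (Fin p) (Fin p) ℝ)
    (α : EuclideanSpace ℝ (Fin K)) (Cmin Cmax : ℝ) : Prop :=
  (∀ μ ∈ spectrum ℝ (matM n W α), Cmin ≤ μ) ∧ (∀ μ ∈ spectrum ℝ (matU n W α), μ ≤ Cmax)

/-- `‖W_k‖₁ ≤ C_W` for all `k` (maximal absolute column sum). -/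
def ColumnCond (W : Fin K → Matrix (Fin p) (Fin p) ℝ) (CW : ℝ) : Prop :=
  ∀ k v, ∑ t, |W k t v| ≤ CW

/-- `‖M⁰_{Sᶜ,S} (M⁰_{S,S})⁻¹‖_∞ ≤ 1 - C_M` (maximal absolute row sum). -/
def IrrepCond (n : ℕ) (W : Fin K → Matrix (Fin p) (Fin p) ℝ)
    (α : EuclideanSpace ℝ (Fin K)) (CM : ℝ) : Prop :=
  ∀ r, ∑ c, |irrepMatrix (matM n W α) (supp α) r c| ≤ 1 - CM

end IsingSim

end

/-! Stacking the pairs (i, j) turns -l into a logistic-regression loss with entries bounded by C_W.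
Its gradient at α⁰ has mean zero, because given the other coordinates y_ij is Bernoulli with success
probability the sigmoid of its linear predictor (`sum_exponent_mul_residual`). Put s = √(log p / n).
Hoeffding's inequality and union bounds (`measureReal_badEvent_le`) show that, with probability
tending to one, every score coordinate is below D s, those in S are below ε s (ε may be any small
constant, since |S| is bounded), and the Hessian entries are within T s of their means. The sample
curvature at α⁰ is then at least Cmin - K T s ≥ Cmin / 2.

The rest is deterministic (`oracleEvent_of_notMem_badEvent`). By the local quadratic lower bound
`softplus_quadratic_lower`, the loss on a sphere of radius r of order √K s exceeds its value at α⁰,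
and convexity traps ᾱ inside (`exists_isArgmin_loss`). The same argument among vectors supported on
S, where the penalty slopes λ/|ᾱ_k| are at most ε s, yields a restricted minimizer within M s of α⁰
(`exists_adaptive_minimizer`). This distance is below the smallest signal, so no coordinate in S
vanishes. Off S, |ᾱ_k| ≤ r makes λ/|ᾱ_k| at least λ/r, which dominates a score of order s exactly
because λ is large against √K log p / n. Hence the restricted minimizer is optimal among all
vectors, and strict convexity makes it unique. -/

noncomputable section

namespace IsingSim

/-! ### The softplus function -/

/-- The softplus function `t ↦ log (1 + exp t)`. -/
def softplus (t : ℝ) : ℝ := Real.log (1 + Real.exp t)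

theorem sigmoid_eq_exp_div (a : ℝ) : Real.sigmoid a = Real.exp a / (1 + Real.exp a) := by
  rw [Real.sigmoid_def, Real.exp_neg]
  have := Real.exp_pos a
  field_simp
  ring

/-- `softplus (a + s) - softplus a` is the log moment generating function at `s` of a Bernoulli
variable with mean `sigmoid a`; Jensen's inequality for `exp` bounds it below. -/
theorem softplus_tangent (a s : ℝ) :
    softplus a + Real.sigmoid a * s ≤ softplus (a + s) := by
  have ha := Real.exp_pos a
  have hs := Real.exp_pos s
  have hσ := Real.sigmoid_pos a
  have hσ1 := Real.sigmoid_lt_one a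
  have h1 : Real.exp (Real.sigmoid a * s) ≤
      (1 - Real.sigmoid a) + Real.sigmoid a * Real.exp s := by
    have := convexOn_exp.2 (Set.mem_univ 0) (Set.mem_univ s)
      (sub_nonneg.2 hσ1.le) hσ.le (by ring)
    simpa using this
  have h2 : 1 + Real.exp (a + s) =
      (1 + Real.exp a) * ((1 - Real.sigmoid a) + Real.sigmoid a * Real.exp s) := by
    rw [sigmoid_eq_exp_div, Real.exp_add]
    field_simp
    ring
  have h3 : 0 < (1 - Real.sigmoid a) + Real.sigmoid a * Real.exp s :=
    lt_of_lt_of_le (Real.exp_pos _) h1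
  unfold softplus
  rw [h2, Real.log_mul (by positivity) h3.ne']
  have := Real.log_le_log (Real.exp_pos _) h1
  rw [Real.log_exp] at this
  linarith

/-- Two tangent lines in succession, at `a` and at the midpoint `a + s / 2`; the change of slope is
the gain. -/
theorem softplus_bregman_lower (a s : ℝ) :
    softplus a + Real.sigmoid a * s + (Real.sigmoid (a + s / 2) - Real.sigmoid a) * (s / 2)
      ≤ softplus (a + s) := by
  have h1 := softplus_tangent a (s / 2)
  have h2 := softplus_tangent (a + s / 2) (s / 2)
  rw [add_assoc a, add_halves] at h2
  linarith

theorem softplus_tangent_lt (a : ℝ) {s : ℝ} (hs : s ≠ 0) :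
    softplus a + Real.sigmoid a * s < softplus (a + s) := by
  refine lt_of_lt_of_le ?_ (softplus_bregman_lower a s)
  have : 0 < (Real.sigmoid (a + s / 2) - Real.sigmoid a) * (s / 2) := by
    rcases lt_or_gt_of_ne hs with h | h
    · exact mul_pos_of_neg_of_neg
        (sub_neg.2 (Real.sigmoid_lt (by linarith))) (by linarith)
    · exact mul_pos (sub_pos.2 (Real.sigmoid_lt (by linarith))) (by linarith)
  linarith

theorem abs_sigmoid_sub_le (a b : ℝ) : |Real.sigmoid a - Real.sigmoid b| ≤ |a - b| := by
  have h : LipschitzWith 1 Real.sigmoid := by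
    refine lipschitzWith_of_nnnorm_deriv_le differentiable_sigmoid fun x => ?_
    rw [← NNReal.coe_le_coe, coe_nnnorm, Real.deriv_sigmoid, Real.norm_eq_abs, NNReal.coe_one]
    have h0 := Real.sigmoid_pos x
    have h1 := Real.sigmoid_lt_one x
    rw [abs_of_nonneg (by nlinarith)]
    nlinarith
  simpa [Real.dist_eq] using h.dist_le_mul a b

theorem softplus_bregman_upper (a s : ℝ) :
    softplus (a + s) ≤ softplus a + Real.sigmoid a * s + s ^ 2 := by
  have h1 := softplus_tangent (a + s) (-s)
  rw [add_neg_cancel_right] at h1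
  have h2 := abs_sigmoid_sub_le (a + s) a
  have h3 : (Real.sigmoid (a + s) - Real.sigmoid a) * s ≤ s ^ 2 := by
    calc _ ≤ |(Real.sigmoid (a + s) - Real.sigmoid a) * s| := le_abs_self _
      _ = |Real.sigmoid (a + s) - Real.sigmoid a| * |s| := abs_mul _ _
      _ ≤ |a + s - a| * |s| := by gcongr
      _ = s ^ 2 := by rw [add_sub_cancel_left, ← sq, sq_abs]
  linarith

/-- The increment is exactly `σ(1 - σ)` times `(e^t - 1)(1 + e^a) / (1 + e^(a+t))`, and that factor
is at least `t / 2` on `[0, 1]`, uniformly in `a`. Thus curvature at the centre controls the whole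
unit neighbourhood. -/
theorem sigmoid_increment_of_nonneg (a : ℝ) {t : ℝ} (h0 : 0 ≤ t) (h1 : t ≤ 1) :
    Real.sigmoid a * (1 - Real.sigmoid a) * (t / 2) ≤ Real.sigmoid (a + t) - Real.sigmoid a := by
  have ha := Real.exp_pos a
  have ht := Real.exp_pos t
  have ht1 := Real.add_one_le_exp t
  have key : t / 2 ≤ (Real.exp t - 1) * (1 + Real.exp a) / (1 + Real.exp a * Real.exp t) := by
    rw [le_div_iff₀ (by positivity)]
    nlinarith [mul_nonneg h0 ha.le, mul_nonneg (mul_nonneg h0 ha.le) ht.le,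
      mul_nonneg h0 (sub_nonneg.2 h1), mul_nonneg ha.le (sub_nonneg.2 ht1),
      mul_nonneg (mul_nonneg ha.le (sub_nonneg.2 ht1)) (by linarith : (0:ℝ) ≤ 2 - t),
      mul_nonneg (mul_nonneg ha.le h0) (sub_nonneg.2 h1)]
  have e : Real.sigmoid (a + t) - Real.sigmoid a = Real.sigmoid a * (1 - Real.sigmoid a) *
      ((Real.exp t - 1) * (1 + Real.exp a) / (1 + Real.exp a * Real.exp t)) := by
    rw [sigmoid_eq_exp_div, sigmoid_eq_exp_div, Real.exp_add]
    field_simp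
    ring
  rw [e]
  have h0 := Real.sigmoid_pos a
  have h1 := Real.sigmoid_lt_one a
  exact mul_le_mul_of_nonneg_left key (mul_nonneg h0.le (by linarith))

theorem sigmoid_increment (a : ℝ) {t : ℝ} (h : |t| ≤ 1) :
    Real.sigmoid a * (1 - Real.sigmoid a) * (t ^ 2 / 2) ≤
      (Real.sigmoid (a + t) - Real.sigmoid a) * t := by
  rcases le_total 0 t with h0 | h0
  · have := mul_le_mul_of_nonneg_right
      (sigmoid_increment_of_nonneg a h0 (le_trans (le_abs_self t) h)) h0
    linarith
  · have := mul_le_mul_of_nonneg_right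
      (sigmoid_increment_of_nonneg (-a) (neg_nonneg.2 h0) (le_trans (neg_le_abs t) h))
      (neg_nonneg.2 h0)
    rw [← neg_add, Real.sigmoid_neg, Real.sigmoid_neg] at this
    linarith

theorem softplus_quadratic_lower (a : ℝ) {s : ℝ} (h : |s| ≤ 1) :
    softplus a + Real.sigmoid a * s + Real.sigmoid a * (1 - Real.sigmoid a) * s ^ 2 / 8
      ≤ softplus (a + s) := by
  have h1 := softplus_bregman_lower a s
  have h2 := sigmoid_increment a (t := s / 2) (by rw [abs_div]; norm_num; linarith)
  linarith

/-! ### Minimizers of convex functions -/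

/-- A convex function that is larger on a sphere than at its centre has a minimizer inside. -/
theorem exists_minimizer_of_sphere {E : Type*} [NormedAddCommGroup E] [NormedSpace ℝ E]
    [ProperSpace E] {V : Set E} (hV : IsClosed V) {f : E → ℝ} (hf : ConvexOn ℝ V f)
    (hc : Continuous f) {x₀ : E} (hx₀ : x₀ ∈ V) {r : ℝ} (hr : 0 < r)
    (hs : ∀ x ∈ V, ‖x - x₀‖ = r → f x₀ < f x) :
    ∃ x ∈ V, ‖x - x₀‖ ≤ r ∧ ∀ y ∈ V, f x ≤ f y := by
  have hcomp : IsCompact (Metric.closedBall x₀ r ∩ V) :=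
    (isCompact_closedBall x₀ r).inter_right hV
  obtain ⟨x, hx, hmin⟩ := hcomp.exists_isMinOn
    ⟨x₀, Metric.mem_closedBall_self hr.le, hx₀⟩ hc.continuousOn
  refine ⟨x, hx.2, by simpa [dist_eq_norm] using hx.1, fun y hy => ?_⟩
  by_cases hyr : ‖y - x₀‖ ≤ r
  · exact hmin ⟨by simpa [dist_eq_norm] using hyr, hy⟩
  push Not at hyr
  have h0 : f x ≤ f x₀ := hmin ⟨Metric.mem_closedBall_self hr.le, hx₀⟩
  have hpos : 0 < ‖y - x₀‖ := hr.trans hyr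
  -- The segment from `x₀` to `y` crosses the sphere at parameter `θ`; convexity carries the excess
  -- there on to `y`.
  set θ := r / ‖y - x₀‖ with hθ
  have hθ0 : 0 < θ := div_pos hr hpos
  have hθ1 : θ < 1 := (div_lt_one hpos).2 hyr
  have hz := hf.1 hx₀ hy (sub_nonneg.2 hθ1.le) hθ0.le (by ring)
  have hzf := hf.2 hx₀ hy (sub_nonneg.2 hθ1.le) hθ0.le (by ring)
  have hzr : ‖(1 - θ) • x₀ + θ • y - x₀‖ = r := by
    have : (1 - θ) • x₀ + θ • y - x₀ = θ • (y - x₀) := by module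
    rw [this, norm_smul, Real.norm_of_nonneg hθ0.le, hθ, div_mul_cancel₀ _ hpos.ne']
  have h1 := hs _ hz hzr
  rw [smul_eq_mul, smul_eq_mul] at hzf
  have h2 : θ * f x₀ < θ * f y := by linarith
  exact h0.trans (lt_of_mul_lt_mul_left h2 hθ0.le).le

/-! ### Logistic regression with arbitrary rows -/

section Logistic

variable {K : ℕ} {ι : Type*} [Fintype ι]

/-- The linear predictor of a row `x`. -/
def lin (x : Fin K → ℝ) (α : EuclideanSpace ℝ (Fin K)) : ℝ := ∑ k, α k * x k

theorem lin_add (x : Fin K → ℝ) (α β : EuclideanSpace ℝ (Fin K)) :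
    lin x (α + β) = lin x α + lin x β := by
  simp [lin, add_mul, Finset.sum_add_distrib]

theorem lin_smul (x : Fin K → ℝ) (t : ℝ) (α : EuclideanSpace ℝ (Fin K)) :
    lin x (t • α) = t * lin x α := by
  simp [lin, mul_assoc, Finset.mul_sum]

theorem continuous_lin (x : Fin K → ℝ) : Continuous (lin x) := by
  unfold lin
  fun_prop

theorem sum_abs_le_sqrt_card_mul_norm {S : Finset (Fin K)} {v : EuclideanSpace ℝ (Fin K)}
    (hv : ∀ k ∉ S, v k = 0) : ∑ k, |v k| ≤ √(S.card : ℝ) * ‖v‖ := by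
  have h1 : ∑ k, |v k| = ∑ k ∈ S, |v k| :=
    (Finset.sum_subset (Finset.subset_univ S) fun k _ hk => by simp [hv k hk]).symm
  rw [h1, EuclideanSpace.norm_eq, ← Real.sqrt_mul (Nat.cast_nonneg _)]
  refine Real.le_sqrt_of_sq_le ?_
  refine (sq_sum_le_card_mul_sum_sq (s := S) (f := fun k => |v k|)).trans ?_
  refine mul_le_mul_of_nonneg_left ?_ (Nat.cast_nonneg _)
  exact Finset.sum_le_sum_of_subset_of_nonneg (Finset.subset_univ S) fun _ _ _ => sq_nonneg _

theorem abs_lin_le_sum {x : Fin K → ℝ} {C : ℝ} {S : Finset (Fin K)}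
    (hx : ∀ k ∈ S, |x k| ≤ C) {v : EuclideanSpace ℝ (Fin K)} (hv : ∀ k ∉ S, v k = 0) :
    |lin x v| ≤ C * ∑ k, |v k| := by
  rw [Finset.mul_sum]
  refine (Finset.abs_sum_le_sum_abs _ _).trans (Finset.sum_le_sum fun k _ => ?_)
  by_cases hk : k ∈ S
  · rw [abs_mul, mul_comm]
    exact mul_le_mul_of_nonneg_right (hx k hk) (abs_nonneg _)
  · simp [hv k hk]

theorem abs_lin_le {x : Fin K → ℝ} {C : ℝ} (hC : 0 ≤ C) {S : Finset (Fin K)}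
    (hx : ∀ k ∈ S, |x k| ≤ C) {v : EuclideanSpace ℝ (Fin K)} (hv : ∀ k ∉ S, v k = 0) :
    |lin x v| ≤ C * (√(S.card : ℝ) * ‖v‖) :=
  (abs_lin_le_sum hx hv).trans
    (mul_le_mul_of_nonneg_left (sum_abs_le_sqrt_card_mul_norm hv) hC)

/-- The normalized negative log-likelihood of logistic regression. -/
def loss (x : ι → Fin K → ℝ) (y : ι → ℝ) (α : EuclideanSpace ℝ (Fin K)) : ℝ :=
  (∑ i, (softplus (lin (x i) α) - y i * lin (x i) α)) / (Fintype.card ι : ℝ)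

/-- The gradient of `loss`. -/
def score (x : ι → Fin K → ℝ) (y : ι → ℝ) (α : EuclideanSpace ℝ (Fin K)) (k : Fin K) : ℝ :=
  (∑ i, (Real.sigmoid (lin (x i) α) - y i) * x i k) / (Fintype.card ι : ℝ)

/-- The quadratic form of the Hessian of `loss`. -/
def curv (x : ι → Fin K → ℝ) (α v : EuclideanSpace ℝ (Fin K)) : ℝ :=
  (∑ i, Real.sigmoid (lin (x i) α) * (1 - Real.sigmoid (lin (x i) α)) * lin (x i) v ^ 2)
    / (Fintype.card ι : ℝ)

variable (x : ι → Fin K → ℝ) (y : ι → ℝ)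

theorem lin_score (α v : EuclideanSpace ℝ (Fin K)) :
    lin (score x y α) v =
      (∑ i, (Real.sigmoid (lin (x i) α) - y i) * lin (x i) v) / (Fintype.card ι : ℝ) := by
  rw [lin]
  simp_rw [score, mul_div_assoc', ← Finset.sum_div, Finset.mul_sum]
  rw [Finset.sum_comm]
  congr 1
  refine Finset.sum_congr rfl fun i _ => ?_
  rw [show lin (x i) v = ∑ k, v k * x i k from rfl, Finset.mul_sum]
  exact Finset.sum_congr rfl fun k _ => mul_left_comm _ _ _

theorem loss_tangent (α v : EuclideanSpace ℝ (Fin K)) :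
    loss x y α + lin (score x y α) v ≤ loss x y (α + v) := by
  rw [lin_score]
  unfold loss
  rw [← add_div, ← Finset.sum_add_distrib]
  refine div_le_div_of_nonneg_right (Finset.sum_le_sum fun i _ => ?_) (Nat.cast_nonneg _)
  rw [lin_add]
  linarith [softplus_tangent (lin (x i) α) (lin (x i) v)]

theorem loss_tangent_lt (α : EuclideanSpace ℝ (Fin K)) {v : EuclideanSpace ℝ (Fin K)}
    (hv : ∃ i, lin (x i) v ≠ 0) :
    loss x y α + lin (score x y α) v < loss x y (α + v) := by
  obtain ⟨i₀, hi₀⟩ := hv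
  have : Nonempty ι := ⟨i₀⟩
  rw [lin_score]
  unfold loss
  rw [← add_div, ← Finset.sum_add_distrib]
  refine div_lt_div_of_pos_right (Finset.sum_lt_sum (fun i _ => ?_) ⟨i₀, Finset.mem_univ _, ?_⟩)
    (Nat.cast_pos.2 Fintype.card_pos)
  · rw [lin_add]
    linarith [softplus_tangent (lin (x i) α) (lin (x i) v)]
  · rw [lin_add]
    linarith [softplus_tangent_lt (lin (x i₀) α) hi₀]

theorem loss_quadratic_lower (α : EuclideanSpace ℝ (Fin K)) {v : EuclideanSpace ℝ (Fin K)}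
    (hv : ∀ i, |lin (x i) v| ≤ 1) :
    loss x y α + lin (score x y α) v + curv x α v / 8 ≤ loss x y (α + v) := by
  rw [lin_score]
  unfold loss curv
  rw [div_right_comm _ _ (8 : ℝ), Finset.sum_div _ _ (8 : ℝ), ← add_div, ← add_div,
    ← Finset.sum_add_distrib, ← Finset.sum_add_distrib]
  refine div_le_div_of_nonneg_right (Finset.sum_le_sum fun i _ => ?_) (Nat.cast_nonneg _)
  rw [lin_add]
  linarith [softplus_quadratic_lower (lin (x i) α) (hv i)]

theorem loss_quadratic_upper (α v : EuclideanSpace ℝ (Fin K)) :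
    loss x y (α + v) ≤ loss x y α + lin (score x y α) v
      + (∑ i, lin (x i) v ^ 2) / (Fintype.card ι : ℝ) := by
  rw [lin_score]
  unfold loss
  rw [← add_div, ← add_div, ← Finset.sum_add_distrib, ← Finset.sum_add_distrib]
  refine div_le_div_of_nonneg_right (Finset.sum_le_sum fun i _ => ?_) (Nat.cast_nonneg _)
  rw [lin_add]
  linarith [softplus_bregman_upper (lin (x i) α) (lin (x i) v)]

theorem continuous_loss : Continuous (loss x y) := by
  unfold loss softplus
  refine Continuous.div_const (continuous_finsetSum _ fun i _ => ?_) _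
  have h := continuous_lin (x i)
  refine Continuous.sub (Continuous.log (by fun_prop) fun a => ?_) (by fun_prop)
  positivity

theorem convexOn_loss : ConvexOn ℝ Set.univ (loss x y) := by
  refine ⟨convex_univ, fun α _ β _ a b ha hb hab => ?_⟩
  set z := a • α + b • β with hz
  have h1 := loss_tangent x y z (b • (α - β))
  have h2 := loss_tangent x y z (a • (β - α))
  have e1 : z + b • (α - β) = α := by
    rw [hz]
    calc _ = (a + b) • α := by module
      _ = α := by rw [hab, one_smul]
  have e2 : z + a • (β - α) = β := by
    rw [hz]
    calc _ = (a + b) • β := by module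
      _ = β := by rw [hab, one_smul]
  rw [e1, lin_smul] at h1
  rw [e2, lin_smul] at h2
  have e3 : lin (score x y z) (β - α) = - lin (score x y z) (α - β) := by
    rw [← neg_sub, ← neg_one_smul ℝ, lin_smul]
    ring
  rw [e3] at h2
  rw [smul_eq_mul, smul_eq_mul]
  calc loss x y z = a * loss x y z + b * loss x y z := by rw [← add_mul, hab, one_mul]
    _ ≤ _ := by linarith [mul_le_mul_of_nonneg_left h1 ha, mul_le_mul_of_nonneg_left h2 hb]

theorem abs_score_sub_le [Nonempty ι] {C : ℝ} (hx : ∀ i k, |x i k| ≤ C)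
    {S : Finset (Fin K)} (α : EuclideanSpace ℝ (Fin K)) {v : EuclideanSpace ℝ (Fin K)}
    (hv : ∀ k ∉ S, v k = 0) (k : Fin K) :
    |score x y (α + v) k - score x y α k| ≤ C * (√(S.card : ℝ) * ‖v‖) * C := by
  have hC : 0 ≤ C := (abs_nonneg _).trans (hx (Classical.arbitrary ι) k)
  unfold score
  rw [← sub_div, ← Finset.sum_sub_distrib, abs_div, Nat.abs_cast,
    div_le_iff₀ (Nat.cast_pos.2 Fintype.card_pos), mul_comm _ (Fintype.card ι : ℝ)]
  refine (Finset.abs_sum_le_sum_abs _ _).trans ?_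
  rw [← nsmul_eq_mul, ← Finset.card_univ]
  refine Finset.sum_le_card_nsmul _ _ _ fun i _ => ?_
  rw [← sub_mul, sub_sub_sub_cancel_right, abs_mul]
  refine mul_le_mul ?_ (hx i k) (abs_nonneg _) (by positivity)
  refine (abs_sigmoid_sub_le _ _).trans ?_
  rw [lin_add, add_sub_cancel_left]
  exact abs_lin_le hC (fun k _ => hx i k) hv

/-- First-order condition for a minimizer of the loss plus a convex penalty. -/
theorem variational_inequality {V : Set (EuclideanSpace ℝ (Fin K))}
    {P : EuclideanSpace ℝ (Fin K) → ℝ} (hP : ConvexOn ℝ V P)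
    {α β : EuclideanSpace ℝ (Fin K)} (hα : α ∈ V) (hβ : β ∈ V)
    (hmin : ∀ γ ∈ V, loss x y α + P α ≤ loss x y γ + P γ) :
    0 ≤ lin (score x y α) (β - α) + P β - P α := by
  by_contra! hc
  set c := lin (score x y α) (β - α) + P β - P α with hcdef
  set q := (∑ i, lin (x i) (β - α) ^ 2) / (Fintype.card ι : ℝ) with hq
  have hq0 : 0 ≤ q := by positivity
  have hqc : 0 < q - c := by linarith
  -- This step length lies in `(0, 1]` and gives `c + t * q = t * c < 0`, whereas minimality and the
  -- quadratic upper bound along the segment force `0 ≤ t * (c + t * q)`.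
  set t := -c / (q - c) with ht
  have ht0 : 0 < t := div_pos (by linarith) hqc
  have ht1 : t ≤ 1 := (div_le_one hqc).2 (by linarith)
  have e : α + t • (β - α) = (1 - t) • α + t • β := by module
  have h1 := hmin _ (hP.1 hα hβ (sub_nonneg.2 ht1) ht0.le (by ring))
  have h2 := hP.2 hα hβ (sub_nonneg.2 ht1) ht0.le (by ring)
  have h3 := loss_quadratic_upper x y α (t • (β - α))
  have h4 : (∑ i, lin (x i) (t • (β - α)) ^ 2) / (Fintype.card ι : ℝ) = t ^ 2 * q := by
    rw [hq, mul_div_assoc', Finset.mul_sum]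
    simp_rw [lin_smul, mul_pow]
  rw [h4, lin_smul, e] at h3
  rw [smul_eq_mul, smul_eq_mul] at h2
  have h5 : 0 ≤ t * (c + t * q) := by
    rw [hcdef]
    linarith
  have h6 : t * (q - c) = -c := div_mul_cancel₀ _ hqc.ne'
  have h7 : 0 ≤ c + t * q := nonneg_of_mul_nonneg_right h5 ht0
  nlinarith

end Logistic

/-! ### Deterministic analysis of the initial and adaptive lasso estimators -/

section AdaptiveLasso

variable {K : ℕ} {ι : Type*} [Fintype ι]

/-- The adaptive lasso penalty, for vectors that vanish wherever `αbar` does. -/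
def penalty (lam : ℝ) (αbar α : EuclideanSpace ℝ (Fin K)) : ℝ :=
  lam * ∑ k, |α k| / |αbar k|

theorem convexOn_penalty {lam : ℝ} (hlam : 0 ≤ lam) (αbar : EuclideanSpace ℝ (Fin K))
    {V : Set (EuclideanSpace ℝ (Fin K))} (hV : Convex ℝ V) :
    ConvexOn ℝ V (penalty lam αbar) := by
  refine ⟨hV, fun α _ β _ a b ha hb _ => ?_⟩
  unfold penalty
  rw [smul_eq_mul, smul_eq_mul, mul_left_comm a, mul_left_comm b, ← mul_add,
    Finset.mul_sum _ _ a, Finset.mul_sum _ _ b, ← Finset.sum_add_distrib]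
  refine mul_le_mul_of_nonneg_left (Finset.sum_le_sum fun k _ => ?_) hlam
  rw [mul_div_assoc', mul_div_assoc', ← add_div]
  refine div_le_div_of_nonneg_right ?_ (abs_nonneg _)
  refine (abs_add_le _ _).trans ?_
  simp [abs_mul, abs_of_nonneg ha, abs_of_nonneg hb]

theorem continuous_penalty (lam : ℝ) (αbar : EuclideanSpace ℝ (Fin K)) :
    Continuous (penalty lam αbar) := by
  unfold penalty
  fun_prop

/-- The vectors supported on `S`. -/
def supportedOn (S : Finset (Fin K)) : Submodule ℝ (EuclideanSpace ℝ (Fin K)) where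
  carrier := {v | ∀ k ∉ S, v k = 0}
  add_mem' := fun ha hb k hk => by simp [ha k hk, hb k hk]
  zero_mem' := fun _ _ => rfl
  smul_mem' := fun c v hv k hk => by simp [hv k hk]

variable (x : ι → Fin K → ℝ) (y : ι → ℝ)

theorem isArgmin_loss_of_forall_le (hx : ∀ v, v ≠ 0 → ∃ i, lin (x i) v ≠ 0)
    {α : EuclideanSpace ℝ (Fin K)} (h : ∀ β, loss x y α ≤ loss x y β) :
    IsArgmin (loss x y) α := by
  intro β hβ
  have h1 := loss_tangent_lt x y α (hx _ (sub_ne_zero.2 hβ))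
  have h2 := variational_inequality x y (V := Set.univ) (P := fun _ => 0) (α := α) (β := β)
    (convexOn_const 0 convex_univ) trivial trivial (fun γ _ => by simpa using h γ)
  rw [add_sub_cancel] at h1
  linarith

/-- Curvature at the single point `α₀` makes the rows separate directions, so the loss is strictly
convex everywhere. -/
theorem exists_lin_ne_zero {c : ℝ} (hc : 0 < c) {α₀ : EuclideanSpace ℝ (Fin K)}
    (hcurv : ∀ v, c * ‖v‖ ^ 2 ≤ curv x α₀ v) {v : EuclideanSpace ℝ (Fin K)} (hv : v ≠ 0) :
    ∃ i, lin (x i) v ≠ 0 := by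
  by_contra! h
  have h1 := hcurv v
  have h2 : curv x α₀ v = 0 := by simp [curv, h]
  have h3 : 0 < c * ‖v‖ ^ 2 := by positivity
  linarith

/-- Consistency of the unregularized estimator. -/
theorem exists_isArgmin_loss [Nonempty ι] {C c r G : ℝ} {α₀ : EuclideanSpace ℝ (Fin K)}
    (hx : ∀ i k, |x i k| ≤ C) (hC : 0 ≤ C) (hc : 0 < c)
    (hcurv : ∀ v, c * ‖v‖ ^ 2 ≤ curv x α₀ v) (hr : 0 < r) (hCr : C * (√(K : ℝ) * r) ≤ 1)
    (hG0 : 0 ≤ G) (hG : ∀ k, |score x y α₀ k| ≤ G) (hGr : √(K : ℝ) * G < c * r / 8) :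
    ∃ αbar, IsArgmin (loss x y) αbar ∧ ‖αbar - α₀‖ ≤ r := by
  obtain ⟨α, -, h1, h2⟩ := exists_minimizer_of_sphere isClosed_univ (convexOn_loss x y)
    (continuous_loss x y) (Set.mem_univ α₀) hr (fun β _ hβ => by
      -- On the sphere the curvature gain `c * r ^ 2 / 8` beats the linear term, which is at most
      -- `√K * G * r`.
      have hl := loss_quadratic_lower x y α₀ (v := β - α₀) (fun i => by
        refine (abs_lin_le hC (S := Finset.univ) (fun k _ => hx i k) (by simp)).trans ?_
        rw [hβ, Finset.card_univ, Fintype.card_fin]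
        exact hCr)
      have hs := abs_lin_le hG0 (S := Finset.univ) (fun k _ => hG k) (v := β - α₀) (by simp)
      have hcv := hcurv (β - α₀)
      rw [hβ, Finset.card_univ, Fintype.card_fin] at hs
      rw [hβ] at hcv
      rw [add_sub_cancel] at hl
      have := (abs_le.1 hs).1
      have := mul_lt_mul_of_pos_right hGr hr
      nlinarith)
  exact ⟨α, isArgmin_loss_of_forall_le x y (fun v => exists_lin_ne_zero x hc hcurv)
    (fun β => h2 β trivial), h1⟩

/-- Oracle property of the adaptive lasso, given an initial estimator within `r` of `α₀`. -/
theorem exists_adaptive_minimizer [Nonempty ι] {C c r ρ G g lam : ℝ} {S : Finset (Fin K)}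
    {αbar α₀ : EuclideanSpace ℝ (Fin K)}
    (hx : ∀ i k, |x i k| ≤ C) (hC : 0 ≤ C) (hc : 0 < c)
    (hcurv : ∀ v, c * ‖v‖ ^ 2 ≤ curv x α₀ v) (hlam : 0 < lam)
    (hS : ∀ k ∉ S, α₀ k = 0) (hbar : ‖αbar - α₀‖ ≤ r) (hρ : 0 < ρ)
    (hCρ : C * (√(S.card : ℝ) * ρ) ≤ 1)
    (hG : ∀ k, |score x y α₀ k| ≤ G) (hg0 : 0 ≤ g) (hg : ∀ k ∈ S, |score x y α₀ k| ≤ g)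
    (hsig : ∀ k ∈ S, 2 * r ≤ |α₀ k| ∧ ρ < |α₀ k| ∧ 2 * lam ≤ g * |α₀ k|)
    (hgρ : 2 * (√(S.card : ℝ) * g) < c * ρ / 8)
    (hdual : (G + C * (√(S.card : ℝ) * ρ) * C) * r ≤ lam) :
    ∃ αhat, ‖αhat - α₀‖ ≤ ρ ∧ (∀ k ∈ S, αhat k ≠ 0) ∧ (∀ k ∉ S, αhat k = 0) ∧
      (∀ k ∈ S, αbar k ≠ 0) ∧
      ∀ β, β ≠ αhat → (∀ k, αbar k = 0 → β k = 0) →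
        loss x y αhat + penalty lam αbar αhat < loss x y β + penalty lam αbar β := by
  have hcoord (v : EuclideanSpace ℝ (Fin K)) (k : Fin K) : |v k| ≤ ‖v‖ := by
    simpa using PiLp.norm_apply_le v k
  have hbark (k : Fin K) : |αbar k - α₀ k| ≤ r := (hcoord (αbar - α₀) k).trans hbar
  have hbarS (k : Fin K) (hk : k ∈ S) : |α₀ k| / 2 ≤ |αbar k| := by
    have h1 := (hsig k hk).1
    have h2 := hbark k
    have h3 := abs_sub_abs_le_abs_sub (α₀ k) (αbar k)
    rw [abs_sub_comm] at h3
    linarith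
  have hα₀S (k : Fin K) (hk : k ∈ S) : 0 < |α₀ k| := hρ.trans (hsig k hk).2.1
  -- On `S` the initial estimate keeps at least half of the signal, so the penalty slope is no
  -- larger than the score bound `g`.
  have hw (k : Fin K) (hk : k ∈ S) : lam / |αbar k| ≤ g := by
    have h1 := hbarS k hk
    have h2 := hα₀S k hk
    rw [div_le_iff₀ (by linarith)]
    have := mul_le_mul_of_nonneg_left h1 hg0
    linarith [(hsig k hk).2.2]
  have hpen (β : EuclideanSpace ℝ (Fin K)) (hβ : β ∈ supportedOn S) :
      penalty lam αbar α₀ - penalty lam αbar β ≤ g * (√(S.card : ℝ) * ‖β - α₀‖) := by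
    have hsup : ∀ k ∉ S, (β - α₀) k = 0 := (supportedOn S).sub_mem hβ hS
    refine le_trans ?_ (mul_le_mul_of_nonneg_left (sum_abs_le_sqrt_card_mul_norm hsup) hg0)
    unfold penalty
    rw [← mul_sub, ← Finset.sum_sub_distrib, Finset.mul_sum, Finset.mul_sum]
    refine Finset.sum_le_sum fun k _ => ?_
    by_cases hk : k ∈ S
    · rw [← sub_div, mul_div_assoc', mul_div_right_comm]
      refine (mul_le_mul_of_nonneg_left ?_ (by positivity)).trans
        (mul_le_mul_of_nonneg_right (hw k hk) (abs_nonneg _))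
      rw [PiLp.sub_apply, abs_sub_comm]
      exact abs_sub_abs_le_abs_sub _ _
    · simp [hS k hk, hβ k hk]
  obtain ⟨α, hαS, hαρ, hαmin⟩ := exists_minimizer_of_sphere (V := (supportedOn S : Set _))
    (supportedOn S).closed_of_finiteDimensional
    (f := fun β => loss x y β + penalty lam αbar β)
    (((convexOn_loss x y).subset (Set.subset_univ _) (supportedOn S).convex).add
      (convexOn_penalty hlam.le αbar (supportedOn S).convex))
    ((continuous_loss x y).add (continuous_penalty lam αbar)) (x₀ := α₀) hS hρ
    (fun β hβS hβ => by
      have hsup : ∀ k ∉ S, (β - α₀) k = 0 := (supportedOn S).sub_mem hβS hS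
      -- Score and penalty each cost at most `√|S| * g * ρ`; this is the factor 2 in `hgρ`.
      have hl := loss_quadratic_lower x y α₀ (v := β - α₀) (fun i => by
        refine (abs_lin_le hC (fun k _ => hx i k) hsup).trans ?_
        rw [hβ]
        exact hCρ)
      have hs := abs_lin_le hg0 hg hsup
      have hcv := hcurv (β - α₀)
      have hp := hpen β hβS
      rw [hβ] at hs hcv hp
      rw [add_sub_cancel] at hl
      have := (abs_le.1 hs).1
      have := mul_lt_mul_of_pos_right hgρ hρ
      show loss x y α₀ + penalty lam αbar α₀ < loss x y β + penalty lam αbar β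
      nlinarith)
  have hαsup : ∀ k ∉ S, (α - α₀) k = 0 := (supportedOn S).sub_mem hαS hS
  have hscore (k : Fin K) : |score x y α k| ≤ G + C * (√(S.card : ℝ) * ρ) * C := by
    have h1 := abs_score_sub_le x y hx α₀ hαsup k
    rw [add_sub_cancel] at h1
    have h2 : C * (√(S.card : ℝ) * ‖α - α₀‖) * C ≤ C * (√(S.card : ℝ) * ρ) * C := by gcongr
    have h3 := abs_sub_abs_le_abs_sub (score x y α k) (score x y α₀ k)
    linarith [hG k]
  refine ⟨α, hαρ, fun k hk h0 => ?_, hαS, fun k hk h0 => ?_, fun β hβ hβbar => ?_⟩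
  · have h1 := (hcoord (α - α₀) k).trans hαρ
    rw [PiLp.sub_apply, h0, zero_sub, abs_neg] at h1
    linarith [(hsig k hk).2.1]
  · have h1 := hbarS k hk
    rw [h0, abs_zero] at h1
    linarith [hα₀S k hk]
  -- Split `β - α` at the projection `γ` of `β` onto `S`: the first-order condition handles `γ - α`,
  -- and the penalty off `S` absorbs the score along `β - γ`.
  · set γ : EuclideanSpace ℝ (Fin K) := WithLp.toLp 2 fun k => if k ∈ S then β k else 0 with hγ
    have hγS : γ ∈ supportedOn S := fun k hk => by simp [hγ, hk]
    have h1 := variational_inequality x y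
      (convexOn_penalty hlam.le αbar (supportedOn S).convex) hαS hγS hαmin
    have h2 := loss_tangent_lt x y α (exists_lin_ne_zero x hc hcurv (sub_ne_zero.2 hβ))
    rw [add_sub_cancel] at h2
    have e : β - α = (γ - α) + (β - γ) := by abel
    rw [e, lin_add] at h2
    have h3 : penalty lam αbar γ ≤ penalty lam αbar β + lin (score x y α) (β - γ) := by
      unfold penalty lin
      rw [Finset.mul_sum, Finset.mul_sum, ← Finset.sum_add_distrib]
      refine Finset.sum_le_sum fun k _ => ?_
      by_cases hk : k ∈ S
      · simp [hγ, hk]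
      by_cases hb : αbar k = 0
      · simp [hγ, hk, hb, hβbar k hb]
      have hbk : |αbar k| ≤ r := by
        have := hbark k
        rwa [hS k hk, sub_zero] at this
      have hbpos : 0 < |αbar k| := abs_pos.2 hb
      -- Dual feasibility off `S`: a small `αbar k` means a large weight.
      have hsc : |score x y α k| ≤ lam / |αbar k| := by
        rw [le_div_iff₀ hbpos]
        refine le_trans ?_ hdual
        have := hscore k
        have h0 := abs_nonneg (score x y α k)
        exact mul_le_mul this hbk hbpos.le (h0.trans this)
      have hm := mul_le_mul_of_nonneg_right hsc (abs_nonneg (β k))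
      have hn := neg_abs_le (score x y α k * β k)
      rw [abs_mul] at hn
      have hq : lam * (|β k| / |αbar k|) = lam / |αbar k| * |β k| := by ring
      simp only [hγ, hk, if_false, abs_zero, zero_div, mul_zero, PiLp.sub_apply, sub_zero, hq]
      linarith
    linarith

end AdaptiveLasso

/-! ### The pseudo-likelihood as a logistic loss -/

section PseudoLikelihood

variable {n p K : ℕ}

/-- The rows of all the design matrices, stacked. -/
def rows (W : Fin K → Matrix (Fin p) (Fin p) ℝ) (y : Fin n → Config p) :
    Fin n × Fin p → Fin K → ℝ := fun i => design W (y i.1) i.2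

/-- All the responses, stacked. -/
def responses (y : Fin n → Config p) : Fin n × Fin p → ℝ := fun i => val (y i.1 i.2)

theorem neg_logPL_eq_loss (W : Fin K → Matrix (Fin p) (Fin p) ℝ) (y : Fin n → Config p)
    (α : EuclideanSpace ℝ (Fin K)) : -logPL W y α = loss (rows W y) (responses y) α := by
  unfold logPL loss logPLOne
  rw [← neg_div, ← Finset.sum_neg_distrib, Fintype.sum_prod_type, Fintype.card_prod,
    Fintype.card_fin, Fintype.card_fin, Nat.cast_mul]
  congr 1
  refine Finset.sum_congr rfl fun i _ => ?_
  rw [← Finset.sum_neg_distrib]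
  exact Finset.sum_congr rfl fun j _ => neg_sub _ _

theorem adaptiveObjective_eq_coe (W : Fin K → Matrix (Fin p) (Fin p) ℝ) (y : Fin n → Config p)
    {lam : ℝ} (hlam : 0 < lam) {αbar α : EuclideanSpace ℝ (Fin K)}
    (h : ∀ k, αbar k = 0 → α k = 0) :
    adaptiveObjective W y lam αbar α =
      ((loss (rows W y) (responses y) α + penalty lam αbar α : ℝ) : EReal) := by
  have h1 : ENNReal.ofReal lam * ∑ k, adaptiveWeight αbar k * ENNReal.ofReal |α k| =
      ENNReal.ofReal (penalty lam αbar α) := by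
    unfold penalty
    rw [ENNReal.ofReal_mul hlam.le, ENNReal.ofReal_sum_of_nonneg fun _ _ => by positivity]
    congr 1
    refine Finset.sum_congr rfl fun k _ => ?_
    -- Here the convention `∞ * 0 = 0` matches the real division `0 / 0 = 0` in `penalty`.
    by_cases hk : αbar k = 0
    · simp [hk, h k hk]
    · rw [adaptiveWeight, ← ENNReal.ofReal_inv_of_pos (abs_pos.2 hk),
        ← ENNReal.ofReal_mul (by positivity), inv_mul_eq_div]
  have h2 : 0 ≤ penalty lam αbar α := by
    unfold penalty
    positivity
  rw [adaptiveObjective, h1, EReal.coe_ennreal_ofReal, max_eq_left h2, neg_logPL_eq_loss,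
    EReal.coe_add]

theorem adaptiveObjective_eq_top (W : Fin K → Matrix (Fin p) (Fin p) ℝ) (y : Fin n → Config p)
    {lam : ℝ} (hlam : 0 < lam) {αbar α : EuclideanSpace ℝ (Fin K)} {k : Fin K}
    (hbar : αbar k = 0) (hk : α k ≠ 0) : adaptiveObjective W y lam αbar α = ⊤ := by
  have h1 : ∑ k, adaptiveWeight αbar k * ENNReal.ofReal |α k| = ⊤ := by
    refine ENNReal.sum_eq_top.2 ⟨k, Finset.mem_univ _, ?_⟩
    rw [adaptiveWeight, hbar, abs_zero, ENNReal.ofReal_zero, ENNReal.inv_zero]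
    exact ENNReal.top_mul (ENNReal.ofReal_pos.2 (abs_pos.2 hk)).ne'
  rw [adaptiveObjective, h1, ENNReal.mul_top (ENNReal.ofReal_pos.2 hlam).ne',
    EReal.coe_ennreal_top, EReal.coe_add_top]

theorem val_nonneg (b : Bool) : 0 ≤ val b := by cases b <;> simp [val]

theorem val_le_one (b : Bool) : val b ≤ 1 := by cases b <;> simp [val]

theorem abs_design_le {W : Fin K → Matrix (Fin p) (Fin p) ℝ} (hW : ∀ k, (W k).IsSymm)
    {CW : ℝ} (hC : ColumnCond W CW) (u : Config p) (j : Fin p) (k : Fin K) :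
    |design W u j k| ≤ CW := by
  refine le_trans ?_ (hC k j)
  rw [show design W u j k = ∑ j', W k j j' * val (u j') from rfl]
  refine (Finset.abs_sum_le_sum_abs _ _).trans (Finset.sum_le_sum fun j' _ => ?_)
  rw [abs_mul, (hW k).apply, abs_of_nonneg (val_nonneg _)]
  exact mul_le_of_le_one_right (abs_nonneg _) (val_le_one _)

/-- The contribution of one response vector to the gradient of the loss. -/
def scoreOne (W : Fin K → Matrix (Fin p) (Fin p) ℝ) (α : EuclideanSpace ℝ (Fin K)) (k : Fin K)
    (u : Config p) : ℝ :=
  (∑ j, (Real.sigmoid (lin (design W u j) α) - val (u j)) * design W u j k) / p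

/-- The contribution of one response vector to the Hessian of the loss. -/
def hessOne (W : Fin K → Matrix (Fin p) (Fin p) ℝ) (α : EuclideanSpace ℝ (Fin K))
    (k k' : Fin K) (u : Config p) : ℝ :=
  (∑ j, Real.sigmoid (lin (design W u j) α) * (1 - Real.sigmoid (lin (design W u j) α)) *
    (design W u j k * design W u j k')) / p

theorem abs_sum_div_le {f : Fin p → ℝ} {C : ℝ} (hC : 0 ≤ C) (hf : ∀ j, |f j| ≤ C) :
    |(∑ j, f j) / (p : ℝ)| ≤ C := by
  rw [abs_div, Nat.abs_cast]
  refine div_le_of_le_mul₀ (Nat.cast_nonneg _) hC ?_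
  refine (Finset.abs_sum_le_sum_abs _ _).trans ?_
  refine (Finset.sum_le_card_nsmul _ _ _ fun j _ => hf j).trans ?_
  rw [Finset.card_univ, Fintype.card_fin, nsmul_eq_mul, mul_comm]

theorem abs_scoreOne_le {W : Fin K → Matrix (Fin p) (Fin p) ℝ} (hW : ∀ k, (W k).IsSymm)
    {CW : ℝ} (hCW : 0 ≤ CW) (hC : ColumnCond W CW) (α : EuclideanSpace ℝ (Fin K)) (k : Fin K)
    (u : Config p) : |scoreOne W α k u| ≤ CW := by
  refine abs_sum_div_le hCW fun j => ?_
  rw [abs_mul, ← one_mul CW]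
  refine mul_le_mul ?_ (abs_design_le hW hC u j k) (abs_nonneg _) zero_le_one
  have h1 := Real.sigmoid_pos (lin (design W u j) α)
  have h2 := Real.sigmoid_lt_one (lin (design W u j) α)
  have h3 := val_nonneg (u j)
  have h4 := val_le_one (u j)
  rw [abs_le]
  constructor <;> linarith

theorem abs_hessOne_le {W : Fin K → Matrix (Fin p) (Fin p) ℝ} (hW : ∀ k, (W k).IsSymm)
    {CW : ℝ} (hCW : 0 ≤ CW) (hC : ColumnCond W CW) (α : EuclideanSpace ℝ (Fin K)) (k k' : Fin K)
    (u : Config p) : |hessOne W α k k' u| ≤ CW ^ 2 := by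
  refine abs_sum_div_le (sq_nonneg _) fun j => ?_
  rw [abs_mul, abs_mul (design W u j k), ← one_mul (CW ^ 2), sq]
  have h1 := Real.sigmoid_pos (lin (design W u j) α)
  have h2 := Real.sigmoid_lt_one (lin (design W u j) α)
  refine mul_le_mul ?_ (mul_le_mul (abs_design_le hW hC u j k) (abs_design_le hW hC u j k')
    (abs_nonneg _) hCW) (by positivity) zero_le_one
  rw [abs_of_nonneg (mul_nonneg h1.le (by linarith))]
  nlinarith

theorem score_eq_mean (W : Fin K → Matrix (Fin p) (Fin p) ℝ) (y : Fin n → Config p)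
    (α : EuclideanSpace ℝ (Fin K)) (k : Fin K) :
    score (rows W y) (responses y) α k = (∑ i, scoreOne W α k (y i)) / n := by
  unfold score scoreOne rows responses
  rw [Fintype.sum_prod_type, Fintype.card_prod, Fintype.card_fin, Fintype.card_fin,
    Nat.cast_mul, ← Finset.sum_div, div_div, mul_comm (p : ℝ)]

theorem curv_eq_sum (W : Fin K → Matrix (Fin p) (Fin p) ℝ) (y : Fin n → Config p)
    (α v : EuclideanSpace ℝ (Fin K)) :
    curv (rows W y) α v = ∑ k, ∑ k', v k * v k' * ((∑ i, hessOne W α k k' (y i)) / n) := by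
  unfold curv hessOne rows
  rw [Fintype.sum_prod_type, Fintype.card_prod, Fintype.card_fin, Fintype.card_fin,
    Nat.cast_mul]
  simp_rw [← Finset.sum_div, div_div, mul_comm (p : ℝ), mul_div_assoc', ← Finset.sum_div]
  congr 1
  simp_rw [Finset.mul_sum]
  have h : ∀ x : Fin K → ℝ, lin x v ^ 2 = ∑ k, ∑ k', v k * v k' * (x k * x k') := fun x => by
    rw [sq, lin, Finset.sum_mul_sum]
    exact Finset.sum_congr rfl fun _ _ => Finset.sum_congr rfl fun _ _ => by ring
  simp_rw [h, Finset.mul_sum]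
  simp_rw [Finset.sum_comm (s := (Finset.univ : Finset (Fin K)))
      (t := (Finset.univ : Finset (Fin n))),
    Finset.sum_comm (s := (Finset.univ : Finset (Fin K)))
      (t := (Finset.univ : Finset (Fin p)))]
  refine Finset.sum_congr rfl fun i _ => Finset.sum_congr rfl fun j _ =>
    Finset.sum_congr rfl fun k _ => Finset.sum_congr rfl fun k' _ => by ring

/-! ### The score has mean zero -/

/-- Flip one coordinate. -/
def flip (j : Fin p) (u : Config p) : Config p := Function.update u j (!u j)

theorem flip_flip (j : Fin p) (u : Config p) : flip j (flip j u) = u := by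
  simp [flip]

theorem flip_same (j : Fin p) (u : Config p) : flip j u j = !u j := by simp [flip]

theorem flip_of_ne {j j' : Fin p} (h : j' ≠ j) (u : Config p) : flip j u j' = u j' := by
  simp [flip, h]

theorem design_flip {W : Fin K → Matrix (Fin p) (Fin p) ℝ} (hdiag : ∀ k j, W k j j = 0)
    (j : Fin p) (u : Config p) : design W (flip j u) j = design W u j := by
  ext k
  change ∑ j', W k j j' * val (flip j u j') = ∑ j', W k j j' * val (u j')
  refine Finset.sum_congr rfl fun j' _ => ?_
  by_cases h : j' = j
  · rw [h, hdiag, zero_mul, zero_mul]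
  · rw [flip_of_ne h]

theorem interaction_symm {W : Fin K → Matrix (Fin p) (Fin p) ℝ} (hW : ∀ k, (W k).IsSymm)
    (α : EuclideanSpace ℝ (Fin K)) (j j' : Fin p) :
    interaction W α j j' = interaction W α j' j := by
  refine Finset.sum_congr rfl fun k _ => ?_
  rw [(hW k).apply]

theorem lin_design (W : Fin K → Matrix (Fin p) (Fin p) ℝ) (u : Config p) (j : Fin p)
    (α : EuclideanSpace ℝ (Fin K)) :
    lin (design W u j) α = ∑ j', interaction W α j j' * val (u j') := by
  unfold lin design interaction
  simp only [Matrix.of_apply, Finset.mul_sum, Finset.sum_mul, mul_assoc]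
  exact Finset.sum_comm

/-- Twice the exponent is the full double sum. -/
theorem two_mul_exponent {W : Fin K → Matrix (Fin p) (Fin p) ℝ} (hW : ∀ k, (W k).IsSymm)
    (hdiag : ∀ k j, W k j j = 0) (α : EuclideanSpace ℝ (Fin K)) (u : Config p) :
    2 * exponent W α u = ∑ j, ∑ j', interaction W α j j' * val (u j) * val (u j') := by
  have h1 : exponent W α u = ∑ j, ∑ j', if j < j' then
      interaction W α j j' * val (u j) * val (u j') else 0 := by
    refine Finset.sum_congr rfl fun j _ => ?_
    rw [← Finset.sum_filter]
    refine Finset.sum_congr ?_ fun _ _ => rfl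
    ext
    simp
  have h2 : exponent W α u = ∑ j, ∑ j', if j' < j then
      interaction W α j j' * val (u j) * val (u j') else 0 := by
    rw [h1, Finset.sum_comm]
    refine Finset.sum_congr rfl fun j _ => Finset.sum_congr rfl fun j' _ => ?_
    rw [interaction_symm hW, mul_right_comm]
  rw [two_mul]
  nth_rw 1 [h1]
  rw [h2, ← Finset.sum_add_distrib]
  refine Finset.sum_congr rfl fun j _ => ?_
  rw [← Finset.sum_add_distrib]
  refine Finset.sum_congr rfl fun j' _ => ?_
  rcases lt_trichotomy j j' with h | h | h
  · simp [h, h.not_gt]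
  · subst h
    simp [interaction, hdiag]
  · simp [h, h.not_gt]

/-- The conditional log-odds of coordinate `j` are its linear predictor, which is what ties the
pseudo-likelihood to the Ising model. In the symmetric double sum the row and the column of `j`
contribute equally. -/
theorem exponent_update_true {W : Fin K → Matrix (Fin p) (Fin p) ℝ} (hW : ∀ k, (W k).IsSymm)
    (hdiag : ∀ k j, W k j j = 0) (α : EuclideanSpace ℝ (Fin K)) {u : Config p} {j : Fin p}
    (hu : u j = false) :
    exponent W α (flip j u) = exponent W α u + lin (design W u j) α := by
  have hv : ∀ a, val (flip j u a) = val (u a) + if a = j then 1 else 0 := fun a => by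
    by_cases h : a = j
    · subst h
      simp [flip_same, hu, val]
    · simp [flip_of_ne h, h]
  have hjj : interaction W α j j = 0 := by simp [interaction, hdiag]
  have h1 := two_mul_exponent hW hdiag α (flip j u)
  have h2 := two_mul_exponent hW hdiag α u
  have h3 : ∑ a, interaction W α a j * val (u a) = lin (design W u j) α := by
    rw [lin_design]
    exact Finset.sum_congr rfl fun a _ => by rw [interaction_symm hW]
  simp only [hv, mul_add, add_mul, Finset.sum_add_distrib, mul_ite, mul_one, mul_zero,
    ite_mul, zero_mul, Finset.sum_ite_eq', Finset.mem_univ, if_true, ← h2, h3, hjj] at h1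
  rw [Finset.sum_comm] at h1
  simp only [Finset.sum_ite_eq', Finset.mem_univ, if_true, ← lin_design] at h1
  linarith

/-- Configurations cancel in pairs differing at `j` only. The zero diagonal leaves row `j` of the
design unchanged, and with `η` the linear predictor the two residuals, weighted `1` and `e^η`,
satisfy `σ(η) + (σ(η) - 1) e^η = 0`. -/
theorem sum_exponent_mul_residual {W : Fin K → Matrix (Fin p) (Fin p) ℝ}
    (hW : ∀ k, (W k).IsSymm) (hdiag : ∀ k j, W k j j = 0) (α : EuclideanSpace ℝ (Fin K))
    (k : Fin K) (j : Fin p) :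
    ∑ u : Config p, Real.exp (exponent W α u) *
      ((Real.sigmoid (lin (design W u j) α) - val (u j)) * design W u j k) = 0 := by
  refine Finset.sum_involution (fun u _ => flip j u) (fun u _ => ?_) (fun u _ _ h => ?_)
    (fun _ _ => Finset.mem_univ _) (fun u _ => flip_flip j u)
  · wlog hu : u j = false generalizing u with H
    · have := H (flip j u) (Finset.mem_univ _) (by rw [flip_same]; simpa using hu)
      rwa [flip_flip, add_comm] at this
    rw [exponent_update_true hW hdiag α hu, design_flip hdiag, flip_same, hu, Real.exp_add,
      sigmoid_eq_exp_div]
    have := Real.exp_pos (lin (design W u j) α)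
    simp only [val, Bool.not_false, if_true, Bool.false_eq_true, if_false]
    field_simp
    ring
  · have := congrFun h j
    rw [flip_same] at this
    simp at this

theorem integral_isingPMF (W : Fin K → Matrix (Fin p) (Fin p) ℝ)
    (α : EuclideanSpace ℝ (Fin K)) (f : Config p → ℝ) :
    ∫ u, f u ∂(isingPMF W α).toMeasure =
      ∑ u, Real.exp (exponent W α u) / partitionFunction W α * f u := by
  rw [PMF.integral_eq_sum]
  refine Finset.sum_congr rfl fun u _ => ?_
  rw [isingPMF, PMF.ofFintype_apply, ENNReal.toReal_ofReal
    (div_nonneg (Real.exp_pos _).le (partitionFunction_pos W α).le), smul_eq_mul]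

theorem integral_scoreOne {W : Fin K → Matrix (Fin p) (Fin p) ℝ}
    (hW : ∀ k, (W k).IsSymm) (hdiag : ∀ k j, W k j j = 0) (α : EuclideanSpace ℝ (Fin K))
    (k : Fin K) : ∫ u, scoreOne W α k u ∂(isingPMF W α).toMeasure = 0 := by
  rw [integral_isingPMF]
  simp_rw [scoreOne, div_mul_div_comm, ← Finset.sum_div, Finset.mul_sum]
  rw [Finset.sum_comm, Finset.sum_eq_zero fun j _ => sum_exponent_mul_residual hW hdiag α k j,
    zero_div]

end PseudoLikelihood

/-! ### Concentration of sample means -/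

section Concentration

variable {Ω : Type*} [MeasurableSpace Ω] {μ : Measure Ω} [IsProbabilityMeasure μ] {n : ℕ}

theorem integral_pi_eval {f : Ω → ℝ} (hf : Measurable f) (i : Fin n) :
    ∫ y, f (y i) ∂(Measure.pi fun _ : Fin n => μ) = ∫ u, f u ∂μ := by
  have h := (measurePreserving_eval (fun _ : Fin n => μ) i).map_eq
  conv_rhs => rw [← h]
  rw [integral_map (measurable_pi_apply i).aemeasurable hf.aestronglyMeasurable]

/-- One-sided Hoeffding inequality for the mean of `n` i.i.d. bounded variables. -/
theorem hoeffding_mean_upper (hn : 0 < n) {f : Ω → ℝ} (hf : Measurable f) {B t : ℝ}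
    (hB : 0 ≤ B) (hfB : ∀ u, |f u| ≤ B) (ht : 0 ≤ t) :
    (Measure.pi fun _ : Fin n => μ).real {y | t ≤ (∑ i, f (y i)) / n - ∫ u, f u ∂μ} ≤
      Real.exp (-(n * t ^ 2 / (2 * B ^ 2))) := by
  have hn' : (0 : ℝ) < n := Nat.cast_pos.2 hn
  have hind : ProbabilityTheory.iIndepFun
      (fun (i : Fin n) (y : Fin n → Ω) => f (y i) - ∫ u, f u ∂μ)
      (Measure.pi fun _ : Fin n => μ) :=
    ProbabilityTheory.iIndepFun_pi (X := fun _ u => f u - ∫ u, f u ∂μ)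
      fun _ => (hf.sub_const _).aemeasurable
  have hsub : ∀ i ∈ (Finset.univ : Finset (Fin n)), ProbabilityTheory.HasSubgaussianMGF
      (fun y : Fin n → Ω => f (y i) - ∫ u, f u ∂μ) ((‖B - -B‖₊ / 2) ^ 2)
      (Measure.pi fun _ : Fin n => μ) := fun i _ => by
    have h := ProbabilityTheory.hasSubgaussianMGF_of_mem_Icc
      (μ := Measure.pi fun _ : Fin n => μ) (X := fun y => f (y i)) (a := -B) (b := B)
      (hf.comp (measurable_pi_apply i)).aemeasurable
      (ae_of_all _ fun y => abs_le.1 (hfB (y i)))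
    rwa [integral_pi_eval hf] at h
  have h := ProbabilityTheory.HasSubgaussianMGF.measure_sum_ge_le_of_iIndepFun hind hsub
    (ε := n * t) (by positivity)
  have hset : {y : Fin n → Ω | t ≤ (∑ i, f (y i)) / n - ∫ u, f u ∂μ} =
      {y | n * t ≤ ∑ i, (f (y i) - ∫ u, f u ∂μ)} := by
    ext y
    simp only [Set.mem_ofPred_eq, Finset.sum_sub_distrib, Finset.sum_const, Finset.card_univ,
      Fintype.card_fin, nsmul_eq_mul]
    rw [le_sub_iff_add_le, le_div_iff₀ hn', le_sub_iff_add_le, add_mul, mul_comm t,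
      mul_comm (∫ u, f u ∂μ)]
  rw [hset]
  refine h.trans_eq ?_
  congr 1
  have hc : (((‖B - -B‖₊ / 2) ^ 2 : NNReal) : ℝ) = B ^ 2 := by
    push_cast
    rw [Real.norm_of_nonneg (by linarith)]
    ring
  rw [Finset.sum_const, Finset.card_univ, Fintype.card_fin]
  push_cast at hc ⊢
  rw [nsmul_eq_mul, hc]
  -- For `B = 0` both exponents are divisions by zero, so both sides equal `exp 0`.
  rcases hB.eq_or_lt with rfl | hB'
  · simp
  · field_simp

/-- Two-sided Hoeffding inequality for the mean of `n` i.i.d. bounded variables. -/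
theorem hoeffding_mean (hn : 0 < n) {f : Ω → ℝ} (hf : Measurable f) {B t : ℝ}
    (hB : 0 ≤ B) (hfB : ∀ u, |f u| ≤ B) (ht : 0 ≤ t) :
    (Measure.pi fun _ : Fin n => μ).real {y | t ≤ |(∑ i, f (y i)) / n - ∫ u, f u ∂μ|} ≤
      2 * Real.exp (-(n * t ^ 2 / (2 * B ^ 2))) := by
  have h1 := hoeffding_mean_upper (μ := μ) hn hf hB hfB ht
  have h2 := hoeffding_mean_upper (μ := μ) hn hf.neg hB (fun u => by simpa using hfB u) ht
  rw [two_mul]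
  refine le_trans ?_ (add_le_add h1 h2)
  refine (measureReal_mono ?_).trans (measureReal_union_le _ _)
  intro y hy
  rcases le_abs.1 (show t ≤ |_| from hy) with h | h
  · exact Or.inl h
  · refine Or.inr (show t ≤ _ from ?_)
    simp only [Pi.neg_apply, Finset.sum_neg_distrib, integral_neg, neg_div]
    linarith

end Concentration

/-! ### The Hessian of the pseudo-likelihood -/

section Hessian

variable {n p K : ℕ}

/-- `lin x` as a continuous linear map. -/
def linCLM (x : Fin K → ℝ) : EuclideanSpace ℝ (Fin K) →L[ℝ] ℝ :=
  LinearMap.toContinuousLinearMap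
    { toFun := lin x, map_add' := lin_add x, map_smul' := lin_smul x }

theorem linCLM_apply (x : Fin K → ℝ) (v : EuclideanSpace ℝ (Fin K)) : linCLM x v = lin x v :=
  rfl

theorem lin_single (x : Fin K → ℝ) (k : Fin K) : lin x (EuclideanSpace.single k 1) = x k := by
  simp [lin]

theorem hasFDerivAt_lin (x : Fin K → ℝ) (α : EuclideanSpace ℝ (Fin K)) :
    HasFDerivAt (lin x) (linCLM x) α :=
  (linCLM x).hasFDerivAt

theorem hasDerivAt_softplus (t : ℝ) : HasDerivAt softplus (Real.sigmoid t) t := by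
  rw [sigmoid_eq_exp_div]
  exact ((Real.hasDerivAt_exp t).const_add 1).log (by positivity)

variable {ι : Type*} [Fintype ι] (x : ι → Fin K → ℝ) (y : ι → ℝ)

theorem fderiv_loss_single (α : EuclideanSpace ℝ (Fin K)) (k : Fin K) :
    fderiv ℝ (loss x y) α (EuclideanSpace.single k 1) = score x y α k := by
  have h : HasFDerivAt (loss x y) ((Fintype.card ι : ℝ)⁻¹ • ∑ i,
      (Real.sigmoid (lin (x i) α) • linCLM (x i) - y i • linCLM (x i))) α := by
    have h1 : HasFDerivAt (fun a => ∑ i, (softplus (lin (x i) a) - y i * lin (x i) a))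
        (∑ i, (Real.sigmoid (lin (x i) α) • linCLM (x i) - y i • linCLM (x i))) α :=
      HasFDerivAt.fun_sum fun i _ =>
        ((hasDerivAt_softplus _).comp_hasFDerivAt α (hasFDerivAt_lin (x i) α)).sub
          ((hasFDerivAt_lin (x i) α).const_mul (y i))
    have h2 := h1.const_mul (Fintype.card ι : ℝ)⁻¹
    refine h2.congr_of_eventuallyEq (Eventually.of_forall fun a => ?_)
    exact div_eq_inv_mul _ _
  rw [h.fderiv]
  simp only [_root_.smul_apply, _root_.sum_apply,
    _root_.sub_apply, linCLM_apply, lin_single, smul_eq_mul]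
  rw [score, inv_mul_eq_div]
  simp_rw [sub_mul]

theorem fderiv_score_single (α : EuclideanSpace ℝ (Fin K)) (k k' : Fin K) :
    fderiv ℝ (fun a => score x y a k') α (EuclideanSpace.single k 1) =
      (∑ i, Real.sigmoid (lin (x i) α) * (1 - Real.sigmoid (lin (x i) α)) *
        (x i k * x i k')) / (Fintype.card ι : ℝ) := by
  have h : HasFDerivAt (fun a => score x y a k') ((Fintype.card ι : ℝ)⁻¹ • ∑ i,
      x i k' • (Real.sigmoid (lin (x i) α) * (1 - Real.sigmoid (lin (x i) α))) •
        linCLM (x i)) α := by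
    have h1 : HasFDerivAt (fun a => ∑ i, (Real.sigmoid (lin (x i) a) - y i) * x i k')
        (∑ i, x i k' • (Real.sigmoid (lin (x i) α) * (1 - Real.sigmoid (lin (x i) α))) •
        linCLM (x i)) α :=
      HasFDerivAt.fun_sum fun i _ =>
        (((Real.hasDerivAt_sigmoid _).comp_hasFDerivAt α (hasFDerivAt_lin (x i) α)).sub_const
          (y i)).mul_const (x i k')
    have h2 := h1.const_mul (Fintype.card ι : ℝ)⁻¹
    refine h2.congr_of_eventuallyEq (Eventually.of_forall fun a => ?_)
    exact div_eq_inv_mul _ _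
  rw [h.fderiv]
  simp only [_root_.smul_apply, _root_.sum_apply, linCLM_apply,
    lin_single, smul_eq_mul]
  rw [inv_mul_eq_div]
  congr 1
  exact Finset.sum_congr rfl fun i _ => by ring

theorem neg_hessian_logPL (W : Fin K → Matrix (Fin p) (Fin p) ℝ) (y : Fin n → Config p)
    (α : EuclideanSpace ℝ (Fin K)) (k k' : Fin K) :
    -(hessian (logPL W y) α k k') = (∑ i, hessOne W α k k' (y i)) / n := by
  have h0 : logPL W y = fun a => -loss (rows W y) (responses y) a :=
    funext fun a => by rw [← neg_logPL_eq_loss, neg_neg]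
  have h1 : (fun a => fderiv ℝ (logPL W y) a (EuclideanSpace.single k' 1)) =
      fun a => -score (rows W y) (responses y) a k' := by
    funext a
    rw [h0, fderiv_fun_neg, _root_.neg_apply, fderiv_loss_single]
  rw [hessian, Matrix.of_apply, h1, fderiv_fun_neg, _root_.neg_apply, neg_neg,
    fderiv_score_single]
  unfold hessOne rows
  rw [Fintype.sum_prod_type, Fintype.card_prod, Fintype.card_fin, Fintype.card_fin,
    Nat.cast_mul, ← Finset.sum_div, div_div, mul_comm (p : ℝ)]

theorem matM_apply (hn : 0 < n) (W : Fin K → Matrix (Fin p) (Fin p) ℝ)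
    (α : EuclideanSpace ℝ (Fin K)) (k k' : Fin K) :
    matM n W α k k' = ∫ u, hessOne W α k k' u ∂(isingPMF W α).toMeasure := by
  have hn' : (n : ℝ) ≠ 0 := Nat.cast_ne_zero.2 hn.ne'
  rw [matM, Matrix.of_apply]
  simp_rw [neg_hessian_logPL]
  rw [integral_div, sampleLaw, integral_finsetSum _ fun i _ => Integrable.of_finite]
  simp_rw [integral_pi_eval (measurable_of_finite (hessOne W α k k'))]
  rw [Finset.sum_const, Finset.card_univ, Fintype.card_fin, nsmul_eq_mul,
    mul_div_cancel_left₀ _ hn']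

/-- The quadratic form of a symmetric matrix whose spectrum is bounded below. -/
theorem mul_norm_sq_le_of_spectrum {A : Matrix (Fin K) (Fin K) ℝ} (hA : A.IsSymm) {c : ℝ}
    (hc : ∀ μ ∈ spectrum ℝ A, c ≤ μ) (v : EuclideanSpace ℝ (Fin K)) :
    c * ‖v‖ ^ 2 ≤ ∑ k, ∑ k', v k * v k' * A k k' := by
  -- Subtracting `c` shifts the spectrum into the nonnegative reals.
  have hpsd : (A - algebraMap ℝ _ c).PosSemidef := by
    rw [Matrix.posSemidef_iff_isHermitian_and_spectrum_nonneg]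
    refine ⟨?_, fun r hr => ?_⟩
    · rw [Matrix.IsHermitian, Matrix.conjTranspose_eq_transpose_of_trivial,
        Matrix.transpose_sub, hA.eq, Matrix.algebraMap_eq_diagonal, Matrix.diagonal_transpose]
    · have h1 : r + c ∈ spectrum ℝ A := by
        rw [spectrum.mem_iff] at hr ⊢
        rwa [map_add, ← sub_sub_eq_add_sub]
      have := hc _ h1
      show (0 : ℝ) ≤ r
      linarith
  have h := hpsd.dotProduct_mulVec_nonneg (v : Fin K → ℝ)
  have e : star (v : Fin K → ℝ) ⬝ᵥ ((A - algebraMap ℝ _ c).mulVec (v : Fin K → ℝ)) =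
      ∑ k, ∑ k', v k * v k' * A k k' - c * ‖v‖ ^ 2 := by
    rw [star_trivial, Matrix.sub_mulVec, dotProduct_sub, Algebra.algebraMap_eq_smul_one,
      Matrix.smul_mulVec, Matrix.one_mulVec, dotProduct_smul, EuclideanSpace.norm_sq_eq]
    simp only [dotProduct, Matrix.mulVec, Finset.mul_sum, smul_eq_mul, Real.norm_eq_abs, sq_abs]
    congr 1
    · exact Finset.sum_congr rfl fun k _ => Finset.sum_congr rfl fun k' _ => by ring
    · exact Finset.sum_congr rfl fun k _ => by ring
  linarith

theorem isSymm_matM (hn : 0 < n) (W : Fin K → Matrix (Fin p) (Fin p) ℝ)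
    (α : EuclideanSpace ℝ (Fin K)) : (matM n W α).IsSymm := by
  ext k k'
  rw [Matrix.transpose_apply, matM_apply hn, matM_apply hn]
  unfold hessOne
  simp_rw [mul_comm (design W _ _ k')]

/-- Lower curvature bound for the sample from the population bound. -/
theorem curv_lower {W : Fin K → Matrix (Fin p) (Fin p) ℝ} {α : EuclideanSpace ℝ (Fin K)}
    (hn : 0 < n) {Cmin t : ℝ} (hM : ∀ μ ∈ spectrum ℝ (matM n W α), Cmin ≤ μ) (ht : 0 ≤ t)
    {y : Fin n → Config p}
    (hy : ∀ k k', |(∑ i, hessOne W α k k' (y i)) / n -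
      ∫ u, hessOne W α k k' u ∂(isingPMF W α).toMeasure| ≤ t)
    (v : EuclideanSpace ℝ (Fin K)) :
    (Cmin - K * t) * ‖v‖ ^ 2 ≤ curv (rows W y) α v := by
  have h1 := mul_norm_sq_le_of_spectrum (isSymm_matM hn W α) hM v
  have h2 : (∑ k, |v k|) ^ 2 ≤ K * ‖v‖ ^ 2 := by
    have := sum_abs_le_sqrt_card_mul_norm (S := Finset.univ) (v := v) (by simp)
    rw [Finset.card_univ, Fintype.card_fin] at this
    calc (∑ k, |v k|) ^ 2 ≤ (√(K : ℝ) * ‖v‖) ^ 2 := by gcongr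
      _ = K * ‖v‖ ^ 2 := by rw [mul_pow, Real.sq_sqrt (Nat.cast_nonneg _)]
  -- Entrywise errors `t` perturb the quadratic form by at most `t` times the squared ℓ¹ norm, hence
  -- by `K * t * ‖v‖ ^ 2`.
  have h3 : ∑ k, ∑ k', v k * v k' * matM n W α k k' - curv (rows W y) α v ≤
      t * (∑ k, |v k|) ^ 2 := by
    rw [curv_eq_sum, ← Finset.sum_sub_distrib, sq, Finset.sum_mul_sum, Finset.mul_sum]
    refine Finset.sum_le_sum fun k _ => ?_
    rw [← Finset.sum_sub_distrib, Finset.mul_sum]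
    refine Finset.sum_le_sum fun k' _ => ?_
    rw [← mul_sub, matM_apply hn]
    refine (le_abs_self _).trans ?_
    rw [abs_mul, abs_mul, abs_sub_comm, mul_comm]
    exact mul_le_mul_of_nonneg_right (hy k k') (by positivity)
  nlinarith [mul_le_mul_of_nonneg_left h2 ht]

end Hessian

/-! ### Good and bad events: probability bound and deterministic implication -/

section Events

variable {n p K : ℕ}

/-- Existence of both estimators, the error bound `ρ` and exact support recovery. -/
def OracleEvent (W : Fin K → Matrix (Fin p) (Fin p) ℝ) (α₀ : EuclideanSpace ℝ (Fin K))
    (lam ρ : ℝ) (y : Fin n → Config p) : Prop :=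
  ∃ αbar αhat : EuclideanSpace ℝ (Fin K),
    IsArgmin (fun α => -logPL W y α) αbar ∧
    IsArgmin (adaptiveObjective W y lam αbar) αhat ∧
    ‖αhat - α₀‖ ≤ ρ ∧ (∀ k ∈ supp α₀, αhat k ≠ 0) ∧ (∀ k ∉ supp α₀, αhat k = 0)

/-- The sample score exceeds its bounds, or the sample Hessian is far from its mean. -/
def BadEvent (W : Fin K → Matrix (Fin p) (Fin p) ℝ) (α₀ : EuclideanSpace ℝ (Fin K))
    (G g t : ℝ) : Set (Fin n → Config p) :=
  (⋃ k, {y | G ≤ |(∑ i, scoreOne W α₀ k (y i)) / n -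
      ∫ u, scoreOne W α₀ k u ∂(isingPMF W α₀).toMeasure|}) ∪
  (⋃ k ∈ supp α₀, {y | g ≤ |(∑ i, scoreOne W α₀ k (y i)) / n -
      ∫ u, scoreOne W α₀ k u ∂(isingPMF W α₀).toMeasure|}) ∪
  (⋃ q : Fin K × Fin K, {y | t ≤ |(∑ i, hessOne W α₀ q.1 q.2 (y i)) / n -
      ∫ u, hessOne W α₀ q.1 q.2 u ∂(isingPMF W α₀).toMeasure|})

theorem measureReal_badEvent_le (hn : 0 < n) {W : Fin K → Matrix (Fin p) (Fin p) ℝ}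
    (hW : ∀ k, (W k).IsSymm) {CW : ℝ} (hCW : 0 ≤ CW) (hC : ColumnCond W CW)
    (α₀ : EuclideanSpace ℝ (Fin K)) {G g t : ℝ} (hG : 0 ≤ G) (hg : 0 ≤ g) (ht : 0 ≤ t) :
    (sampleLaw n W α₀).real (BadEvent W α₀ G g t) ≤
      K * (2 * Real.exp (-(n * G ^ 2 / (2 * CW ^ 2)))) +
      (supp α₀).card * (2 * Real.exp (-(n * g ^ 2 / (2 * CW ^ 2)))) +
      (K * K : ℝ) * (2 * Real.exp (-(n * t ^ 2 / (2 * (CW ^ 2) ^ 2)))) := by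
  have hs (k : Fin K) {r : ℝ} (hr : 0 ≤ r) := hoeffding_mean (μ := (isingPMF W α₀).toMeasure)
    hn (measurable_of_finite (scoreOne W α₀ k)) hCW (abs_scoreOne_le hW hCW hC α₀ k) hr
  have hh (q : Fin K × Fin K) := hoeffding_mean (μ := (isingPMF W α₀).toMeasure)
    hn (measurable_of_finite (hessOne W α₀ q.1 q.2)) (sq_nonneg CW)
    (abs_hessOne_le hW hCW hC α₀ q.1 q.2) ht
  unfold BadEvent sampleLaw
  refine (measureReal_union_le _ _).trans (add_le_add
    ((measureReal_union_le _ _).trans (add_le_add ?_ ?_)) ?_)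
  · refine (measureReal_iUnion_fintype_le _).trans ?_
    refine (Finset.sum_le_card_nsmul _ _ _ fun k _ => hs k hG).trans_eq ?_
    rw [Finset.card_univ, Fintype.card_fin, nsmul_eq_mul]
  · refine (measureReal_biUnion_finset_le _ _).trans ?_
    refine (Finset.sum_le_card_nsmul _ _ _ fun k _ => hs k hg).trans_eq ?_
    rw [nsmul_eq_mul]
  · refine (measureReal_iUnion_fintype_le _).trans ?_
    refine (Finset.sum_le_card_nsmul _ _ _ fun q _ => hh q).trans_eq ?_
    rw [Finset.card_univ, Fintype.card_prod, Fintype.card_fin, nsmul_eq_mul, Nat.cast_mul]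

theorem oracleEvent_of_notMem_badEvent (hn : 0 < n) (hp : 0 < p)
    {W : Fin K → Matrix (Fin p) (Fin p) ℝ} (hW : ∀ k, (W k).IsSymm)
    (hdiag : ∀ k j, W k j j = 0) {CW : ℝ} (hCW : 0 ≤ CW) (hC : ColumnCond W CW)
    {α₀ : EuclideanSpace ℝ (Fin K)} {Cmin c r ρ G g t lam : ℝ} (hlam : 0 < lam)
    (hM : ∀ μ ∈ spectrum ℝ (matM n W α₀), Cmin ≤ μ)
    (hc : 0 < c) (hct : c ≤ Cmin - K * t) (hr : 0 < r) (hρ : 0 < ρ)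
    (hG : 0 ≤ G) (hg : 0 ≤ g) (ht : 0 ≤ t)
    (hCr : CW * (√(K : ℝ) * r) ≤ 1) (hCρ : CW * (√((supp α₀).card : ℝ) * ρ) ≤ 1)
    (hGr : √(K : ℝ) * G < c * r / 8) (hgρ : 2 * (√((supp α₀).card : ℝ) * g) < c * ρ / 8)
    (hsig : ∀ k ∈ supp α₀, 2 * r ≤ |α₀ k| ∧ ρ < |α₀ k| ∧ 2 * lam ≤ g * |α₀ k|)
    (hdual : (G + CW * (√((supp α₀).card : ℝ) * ρ) * CW) * r ≤ lam)
    {y : Fin n → Config p} (hy : y ∉ BadEvent W α₀ G g t) :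
    OracleEvent W α₀ lam ρ y := by
  have : Nonempty (Fin n × Fin p) := ⟨(⟨0, hn⟩, ⟨0, hp⟩)⟩
  simp only [BadEvent, Set.mem_union, Set.mem_iUnion, Set.mem_ofPred_eq, not_or, not_exists,
    not_le, integral_scoreOne hW hdiag, sub_zero, ← score_eq_mean] at hy
  obtain ⟨⟨hyG, hyg⟩, hyt⟩ := hy
  have hcurv (v : EuclideanSpace ℝ (Fin K)) : c * ‖v‖ ^ 2 ≤ curv (rows W y) α₀ v :=
    (mul_le_mul_of_nonneg_right hct (sq_nonneg _)).trans
      (curv_lower hn hM ht (fun k k' => (hyt (k, k')).le) v)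
  have hx (i : Fin n × Fin p) (k : Fin K) : |rows W y i k| ≤ CW := abs_design_le hW hC _ _ _
  obtain ⟨αbar, hbar, hbarr⟩ := exists_isArgmin_loss (rows W y) (responses y) hx hCW hc hcurv
    hr hCr hG (fun k => (hyG k).le) hGr
  obtain ⟨αhat, h1, h2, h3, h4, h5⟩ := exists_adaptive_minimizer (rows W y) (responses y) hx hCW
    hc hcurv hlam (S := supp α₀) (fun k hk => by simpa [supp] using hk) hbarr hρ hCρ
    (fun k => (hyG k).le) hg (fun k hk => (hyg k hk).le) hsig hgρ hdual
  refine ⟨αbar, αhat, ?_, fun β hβ => ?_, h1, h2, h3⟩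
  · simp_rw [neg_logPL_eq_loss]
    exact hbar
  · have hhat : ∀ k, αbar k = 0 → αhat k = 0 := fun k hk => h3 k fun hkS => h4 k hkS hk
    rw [adaptiveObjective_eq_coe W y hlam hhat]
    -- A competitor that is nonzero where `αbar` vanishes has objective `⊤`; only the others need
    -- the real-valued comparison.
    by_cases hb : ∀ k, αbar k = 0 → β k = 0
    · rw [adaptiveObjective_eq_coe W y hlam hb]
      exact EReal.coe_lt_coe (h5 β hβ hb)
    · push Not at hb
      obtain ⟨k, hk0, hk1⟩ := hb
      rw [adaptiveObjective_eq_top W y hlam hk0 hk1]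
      exact EReal.coe_lt_top _

theorem minSignal_le {α : EuclideanSpace ℝ (Fin K)} {k : Fin K} (hk : k ∈ supp α) :
    minSignal α ≤ |α k| :=
  ciInf_le (Set.finite_range _).bddBelow (⟨k, hk⟩ : {k // k ∈ supp α})

theorem minSignal_pos {α : EuclideanSpace ℝ (Fin K)} (h : (supp α).Nonempty) :
    0 < minSignal α := by
  have : Nonempty {k // k ∈ supp α} := h.to_subtype
  obtain ⟨k, hk⟩ := exists_eq_ciInf_of_finite (f := fun k : {k // k ∈ supp α} => |α k.1|)
  rw [minSignal, ← hk, abs_pos]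
  exact (Finset.mem_filter.1 k.2).2

end Events

/-! ### Asymptotics -/

section Asymptotic

/-- Subadditivity `1 ≤ μ s + μ t` suffices, so no measurability of either event is required. -/
theorem tendsto_measure_one_of_compl_subset {Ω : ℕ → Type*} [∀ m, MeasurableSpace (Ω m)]
    (μ : ∀ m, Measure (Ω m)) [∀ m, IsProbabilityMeasure (μ m)] (s t : ∀ m, Set (Ω m))
    (hst : ∀ᶠ m in atTop, ∀ y, y ∉ t m → y ∈ s m) {q : ℕ → ℝ}
    (hq : Tendsto q atTop (𝓝 0)) (hqt : ∀ᶠ m in atTop, (μ m).real (t m) ≤ q m) :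
    Tendsto (fun m => μ m (s m)) atTop (𝓝 1) := by
  have h1 : Tendsto (fun m => 1 - ENNReal.ofReal (q m)) atTop (𝓝 1) := by
    have h := ENNReal.Tendsto.sub (tendsto_const_nhds (x := (1 : ℝ≥0∞)) (f := atTop))
      (ENNReal.tendsto_ofReal hq) (Or.inl ENNReal.one_ne_top)
    simpa using h
  refine tendsto_of_tendsto_of_tendsto_of_le_of_le' h1 tendsto_const_nhds ?_
    (Eventually.of_forall fun m => prob_le_one)
  filter_upwards [hst, hqt] with m h2 h3
  have h4 : μ m (t m) ≤ ENNReal.ofReal (q m) := by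
    rw [← ofReal_measureReal]
    exact ENNReal.ofReal_le_ofReal h3
  rw [tsub_le_iff_right]
  calc 1 = μ m Set.univ := measure_univ.symm
    _ ≤ μ m (s m ∪ t m) := measure_mono fun y _ => by
        by_cases hy : y ∈ t m
        · exact Or.inr hy
        · exact Or.inl (h2 y hy)
    _ ≤ μ m (s m) + μ m (t m) := measure_union_le _ _
    _ ≤ _ := by gcongr

variable {n p K : ℕ → ℕ}

/-- The union bound over the score and the Hessian vanishes. -/
theorem tendsto_union_bound (hp : Tendsto p atTop atTop) {a b c : ℝ} (hb : 0 < b)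
    (hK : (fun m => (K m : ℝ)) =o[atTop] fun m => (p m : ℝ) ^ a) :
    Tendsto (fun m => K m * (2 * Real.exp (-(a * Real.log (p m)))) +
      c * (2 * Real.exp (-(b * Real.log (p m)))) +
      (K m * K m : ℝ) * (2 * Real.exp (-(2 * a * Real.log (p m))))) atTop (𝓝 0) := by
  have hlog : Tendsto (fun m => Real.log (p m)) atTop atTop :=
    Real.tendsto_log_atTop.comp (tendsto_natCast_atTop_atTop.comp hp)
  have h1 : Tendsto (fun m => (K m : ℝ) * Real.exp (-(a * Real.log (p m)))) atTop (𝓝 0) := by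
    refine hK.tendsto_div_nhds_zero.congr' ?_
    filter_upwards [hp.eventually_gt_atTop 0] with m hm
    rw [Real.rpow_def_of_pos (Nat.cast_pos.2 hm), Real.exp_neg, div_eq_mul_inv, mul_comm a]
  have h2 : Tendsto (fun m => Real.exp (-(b * Real.log (p m)))) atTop (𝓝 0) :=
    Real.tendsto_exp_neg_atTop_nhds_zero.comp (hlog.const_mul_atTop hb)
  -- The Hessian term is the square of the score term: `K ^ 2 * p ^ (-2a) = (K * p ^ (-a)) ^ 2`.
  have h := ((h1.const_mul 2).add (h2.const_mul (2 * c))).add ((h1.mul h1).const_mul 2)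
  simp only [mul_zero, add_zero] at h
  refine h.congr fun m => ?_
  have e : Real.exp (-(2 * a * Real.log (p m))) =
      Real.exp (-(a * Real.log (p m))) * Real.exp (-(a * Real.log (p m))) := by
    rw [← Real.exp_add]
    ring_nf
  rw [e]
  ring

end Asymptotic

/-! ### The oracle property at the scale `√(log p / n)` -/

instance {n p K : ℕ} (W : Fin K → Matrix (Fin p) (Fin p) ℝ) (α : EuclideanSpace ℝ (Fin K)) :
    IsProbabilityMeasure (sampleLaw n W α) := by
  unfold sampleLaw
  infer_instance

/-- The oracle event follows from the scaling conditions with `s = √(log p / n)`. -/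
theorem oracleEvent_of_scaling {n p K : ℕ} (hn : 0 < n) (hp : 0 < p) (hK : 1 ≤ K)
    {W : Fin K → Matrix (Fin p) (Fin p) ℝ} (hW : ∀ k, (W k).IsSymm)
    (hdiag : ∀ k j, W k j j = 0) {CW : ℝ} (hCW : 0 < CW) (hC : ColumnCond W CW)
    {α₀ : EuclideanSpace ℝ (Fin K)} {Cmin lam s M D T ε κ : ℝ} (hCmin : 0 < Cmin)
    (hlam : 0 < lam) (hM : ∀ μ ∈ spectrum ℝ (matM n W α₀), Cmin ≤ μ)
    (hs : 0 < s) (hM0 : 0 < M) (hD : 0 < D) (hT : 0 ≤ T) (hε : 0 < ε) (hκ : 0 ≤ κ)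
    (hsupp : √((supp α₀).card : ℝ) ≤ κ) (hεκ : 2 * (κ * ε) < Cmin * M / 16)
    (hKA : CW * (32 * D / Cmin) * (K * s) ≤ 1) (hKM : CW * κ * M * (K * s) ≤ 1)
    (hKT : T * (K * s) ≤ Cmin / 2)
    (h4a : (supp α₀).Nonempty → 2 * lam ≤ ε * s * minSignal α₀)
    (h4b : ((D + CW * κ * M * CW) * (32 * D / Cmin) + ε * (32 * D / Cmin) + ε * M) *
      (√(K : ℝ) * s ^ 2) ≤ lam)
    {y : Fin n → Config p} (hy : y ∉ BadEvent W α₀ (D * s) (ε * s) (T * s)) :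
    OracleEvent W α₀ lam (M * s) y := by
  have hK' : (1 : ℝ) ≤ K := by exact_mod_cast hK
  have hsK : 1 ≤ √(K : ℝ) := Real.one_le_sqrt.2 hK'
  have hKK : √(K : ℝ) * √(K : ℝ) = K := Real.mul_self_sqrt (by linarith)
  have hsKs : s ≤ K * s := le_mul_of_one_le_left hs.le hK'
  -- With curvature `Cmin / 2` and radius `A √K s`, the sphere condition reads `D < Cmin * A / 16`;
  -- this `A` makes the right side `2 * D`.
  set A := 32 * D / Cmin with hA
  have hA0 : 0 < A := by positivity
  have hAC : Cmin * A = 32 * D := by rw [hA]; field_simp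
  have hσ0 := Real.sqrt_nonneg ((supp α₀).card : ℝ)
  refine oracleEvent_of_notMem_badEvent hn hp hW hdiag hCW.le hC (c := Cmin / 2)
    (r := A * √(K : ℝ) * s) hlam hM (by linarith) ?_ (by positivity) (by positivity)
    (by positivity) (by positivity) (by positivity) ?_ ?_ ?_ ?_ (fun k hk => ?_) ?_ hy
  · linarith
  · calc CW * (√(K : ℝ) * (A * √(K : ℝ) * s)) = CW * A * (√(K : ℝ) * √(K : ℝ) * s) := by ring
      _ ≤ 1 := by rwa [hKK]
  · calc CW * (√((supp α₀).card : ℝ) * (M * s)) ≤ CW * (κ * (M * (K * s))) := by gcongr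
      _ ≤ 1 := by linarith
  · have : 0 < √(K : ℝ) * s * D := by positivity
    calc √(K : ℝ) * (D * s) < √(K : ℝ) * s * (2 * D) := by linarith
      _ = √(K : ℝ) * s * (Cmin * A) / 16 := by rw [hAC]; ring
      _ = _ := by ring
  · calc 2 * (√((supp α₀).card : ℝ) * (ε * s)) ≤ 2 * (κ * (ε * s)) := by gcongr
      _ = 2 * (κ * ε) * s := by ring
      _ < Cmin * M / 16 * s := by gcongr
      _ = _ := by ring
  · have h1 : 2 * lam ≤ ε * s * |α₀ k| :=
      (h4a ⟨k, hk⟩).trans (mul_le_mul_of_nonneg_left (minSignal_le hk) (by positivity))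
    have hB : 0 ≤ (D + CW * κ * M * CW) * A * (√(K : ℝ) * s ^ 2) := by positivity
    have hpA : 0 < ε * A * (√(K : ℝ) * s ^ 2) := by positivity
    have hpM : 0 < ε * M * (√(K : ℝ) * s ^ 2) := by positivity
    have hεs : 0 < ε * s := by positivity
    -- Both signal bounds come from sandwiching `2 * lam` between a multiple of `√K * s ^ 2` and `ε
    -- * s * |α₀ k|`, then cancelling `ε * s`.
    refine ⟨le_of_mul_le_mul_left ?_ hεs, lt_of_mul_lt_mul_left ?_ hεs.le, by linarith⟩
    · calc ε * s * (2 * (A * √(K : ℝ) * s)) = 2 * (ε * A * (√(K : ℝ) * s ^ 2)) := by ring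
        _ ≤ 2 * lam := by linarith
        _ ≤ _ := h1
    · calc ε * s * (M * s) = ε * M * (1 * s ^ 2) := by ring
        _ ≤ ε * M * (√(K : ℝ) * s ^ 2) := by gcongr
        _ < 2 * lam := by linarith
        _ ≤ _ := h1
  · have hp1 : 0 ≤ ε * A * (√(K : ℝ) * s ^ 2) := by positivity
    have hp2 : 0 ≤ ε * M * (√(K : ℝ) * s ^ 2) := by positivity
    calc (D * s + CW * (√((supp α₀).card : ℝ) * (M * s)) * CW) * (A * √(K : ℝ) * s)
        ≤ (D * s + CW * (κ * (M * s)) * CW) * (A * √(K : ℝ) * s) := by gcongr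
      _ = (D + CW * κ * M * CW) * A * (√(K : ℝ) * s ^ 2) := by ring
      _ ≤ lam := by linarith

/-- The factor `√|S|` is at least 1 unless `S` is empty, and then both vectors are zero. -/
theorem norm_le_sqrt_card_mul {K : ℕ} {α₀ α : EuclideanSpace ℝ (Fin K)} {M L N : ℝ} (hM : 0 ≤ M)
    (h : ‖α - α₀‖ ≤ M * √(L / N)) (hS : ∀ k ∉ supp α₀, α k = 0) :
    ‖α - α₀‖ ≤ M * √(((supp α₀).card : ℝ) * L / N) := by
  rcases (supp α₀).eq_empty_or_nonempty with h0 | h0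
  · have e : α - α₀ = 0 := by
      ext k
      have hk : k ∉ supp α₀ := by simp [h0]
      have h1 : α₀ k = 0 := by simpa [supp] using hk
      simp [hS k hk, h1]
    rw [e, norm_zero]
    positivity
  · refine h.trans (mul_le_mul_of_nonneg_left ?_ hM)
    rw [mul_div_assoc, Real.sqrt_mul (Nat.cast_nonneg _)]
    refine le_mul_of_one_le_left (Real.sqrt_nonneg _) (Real.one_le_sqrt.2 ?_)
    exact_mod_cast h0.card_pos

end IsingSim

end

/-! ### Main theorem: choice of constants and passage to the limit -/

theorem theorem2
    -- sample size, number of responses, number of similarity matrices along the asymptotics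
    (n p K : ℕ → ℕ) (hn : Tendsto n atTop atTop) (hp : Tendsto p atTop atTop)
    -- similarity matrices: symmetric with zero diagonal
    (W : ∀ m, Fin (K m) → Matrix (Fin (p m)) (Fin (p m)) ℝ)
    (hWsymm : ∀ m k, (W m k).IsSymm) (hWdiag : ∀ m k j, W m k j j = 0)
    -- true coefficients, with a bounded number of nonzero ones
    (α₀ : ∀ m, EuclideanSpace ℝ (Fin (K m)))
    (K₀max : ℕ) (hK₀ : ∀ m, (IsingSim.supp (α₀ m)).card ≤ K₀max)
    -- tuning parameter
    (lam : ℕ → ℝ) (hlam : ∀ m, 0 < lam m)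
    (Cmin Cmax CW CM Cnabla : ℝ) (hCmin : 0 < Cmin) (hCmax : 0 < Cmax) (hCW : 0 < CW)
    (hCM : CM ∈ Set.Ioo (0 : ℝ) 1) (hCnabla : 0 < Cnabla)
    (cond1 : ∀ᶠ m in atTop, IsingSim.EigenCond (n m) (W m) (α₀ m) Cmin Cmax)
    (cond2 : ∀ᶠ m in atTop, IsingSim.ColumnCond (W m) CW)
    (cond3 : ∀ᶠ m in atTop, IsingSim.IrrepCond (n m) (W m) (α₀ m) CM)
    (cond4a : Tendsto (fun m => lam m * √(n m : ℝ) /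
      (IsingSim.minSignal (α₀ m) * √(Real.log (p m)))) atTop (𝓝 0))
    (cond4b : Tendsto (fun m => lam m * (n m : ℝ) /
      (√(K m : ℝ) * Real.log (p m))) atTop atTop)
    -- growth conditions
    (growth1 : Tendsto (fun m => (K m : ℝ) * √(Real.log (p m) / (n m : ℝ))) atTop (𝓝 0))
    (growth2 : (fun m => (K m : ℝ)) =o[atTop]
      fun m => (p m : ℝ) ^ (Cnabla ^ 2 / (8 * CW ^ 2))) :
    ∀ M : ℝ, 4 / Cmin < M →
      Tendsto (fun m => IsingSim.sampleLaw (n m) (W m) (α₀ m)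
        {y | ∃ αbar αhat : EuclideanSpace ℝ (Fin (K m)),
          -- the unregularized estimator and the adaptive lasso estimator (they exist)
          IsingSim.IsArgmin (fun α => -IsingSim.logPL (W m) y α) αbar ∧
          IsingSim.IsArgmin (IsingSim.adaptiveObjective (W m) y (lam m) αbar) αhat ∧
          -- (a)
          ‖αhat - α₀ m‖ ≤
            M * √(((IsingSim.supp (α₀ m)).card : ℝ) * Real.log (p m) / (n m : ℝ)) ∧
          -- (b)
          (∀ k ∈ IsingSim.supp (α₀ m), αhat k ≠ 0) ∧
          (∀ k ∉ IsingSim.supp (α₀ m), αhat k = 0)})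
        atTop (𝓝 1) := by
  intro M hM
  have hM0 : 0 < M := lt_trans (by positivity) hM
  set κ : ℝ := √(K₀max : ℝ) with hκ
  have hκ0 : 0 ≤ κ := Real.sqrt_nonneg _
  -- `D` makes the Hoeffding tail of one score coordinate `2 * p ^ (-a)`, with `a` the exponent in
  -- `growth2`. `T` gives `2 * p ^ (-2a)` for each of the `K ^ 2` Hessian entries.
  set D : ℝ := Cnabla / 2 with hD
  set a : ℝ := Cnabla ^ 2 / (8 * CW ^ 2) with ha
  have ha0 : 0 < a := by positivity
  set T : ℝ := 2 * √a * CW ^ 2 with hT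
  -- Small enough for the sphere condition at radius `M * s`; the `+ 1` covers `κ = 0`.
  set ε : ℝ := Cmin * M / (64 * (κ + 1)) with hε
  have hε0 : 0 < ε := by positivity
  have hεκ : 2 * (κ * ε) < Cmin * M / 16 := by
    have h1 : ε * (κ + 1) = Cmin * M / 64 := by rw [hε]; field_simp
    have h2 : 0 < Cmin * M := by positivity
    linarith
  set b : ℝ := ε ^ 2 / (2 * CW ^ 2) with hb
  have hb0 : 0 < b := by positivity
  -- The three summands serve dual feasibility off `S`, the bound `2 * r ≤ |α₀ k|`, and the bound `ρ
  -- < |α₀ k|`.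
  set B : ℝ := (D + CW * κ * M * CW) * (32 * D / Cmin) + ε * (32 * D / Cmin) + ε * M with hB
  set s : ℕ → ℝ := fun m => √(Real.log (p m) / (n m : ℝ)) with hs
  have hlog : ∀ᶠ m in atTop, 0 < Real.log (p m) := by
    filter_upwards [hp.eventually_gt_atTop 1] with m hm
    exact Real.log_pos (by exact_mod_cast hm)
  have hKs (η c : ℝ) (hη : 0 < η) : ∀ᶠ m in atTop, c * (K m * s m) ≤ η := by
    have h := growth1.const_mul c
    rw [mul_zero] at h
    exact (h.eventually_lt_const hη).mono fun _ hm => hm.le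
  refine IsingSim.tendsto_measure_one_of_compl_subset _ _
    (fun m => IsingSim.BadEvent (W m) (α₀ m) (D * s m) (ε * s m) (T * s m)) ?_
    (IsingSim.tendsto_union_bound (c := K₀max) hp hb0 growth2) ?_
  · filter_upwards [hlog, hn.eventually_gt_atTop 0, hp.eventually_gt_atTop 0, cond1, cond2,
      cond4a.eventually_lt_const (half_pos hε0), cond4b.eventually_ge_atTop (max B 1),
      hKs 1 (CW * (32 * D / Cmin)) one_pos, hKs 1 (CW * κ * M) one_pos,
      hKs (Cmin / 2) T (half_pos hCmin)] with m hL hnm hpm h1 h2 h4a h4b hA hKM hKT y hy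
    have hn' : (0 : ℝ) < n m := Nat.cast_pos.2 hnm
    have hsm : 0 < s m := Real.sqrt_pos.2 (div_pos hL hn')
    -- For `K m = 0` the quotient in `cond4b` is a division by zero, hence `0`, contradicting the
    -- lower bound 1 from `max B 1`.
    have hKm : 1 ≤ K m := by
      rw [Nat.one_le_iff_ne_zero]
      intro h0
      have h := (le_max_right B 1).trans h4b
      rw [h0, Nat.cast_zero, Real.sqrt_zero, zero_mul, div_zero] at h
      linarith
    have hcard : √((IsingSim.supp (α₀ m)).card : ℝ) ≤ κ :=
      Real.sqrt_le_sqrt (by exact_mod_cast hK₀ m)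
    have hsdiv : s m = √(Real.log (p m)) / √(n m : ℝ) := Real.sqrt_div hL.le _
    have hsL := Real.sqrt_pos.2 hL
    have hsn := Real.sqrt_pos.2 hn'
    have h4a' : (IsingSim.supp (α₀ m)).Nonempty →
        2 * lam m ≤ ε * s m * IsingSim.minSignal (α₀ m) := fun hne => by
      have hmin := IsingSim.minSignal_pos hne
      rw [div_lt_iff₀ (by positivity)] at h4a
      rw [hsdiv, mul_div_assoc', div_mul_eq_mul_div, le_div_iff₀ hsn]
      linarith
    have h4b' : B * (√(K m : ℝ) * s m ^ 2) ≤ lam m := by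
      have hKpos : (0 : ℝ) < √(K m : ℝ) := Real.sqrt_pos.2 (by exact_mod_cast hKm)
      have h := (le_max_left B 1).trans h4b
      rw [le_div_iff₀ (by positivity)] at h
      rw [Real.sq_sqrt (div_pos hL hn').le, mul_div_assoc', mul_div_assoc', div_le_iff₀ hn']
      exact h
    obtain ⟨αbar, αhat, e1, e2, e3, e4, e5⟩ := IsingSim.oracleEvent_of_scaling hnm hpm hKm
      (hWsymm m) (hWdiag m) hCW h2 hCmin (hlam m) h1.1 hsm hM0 (half_pos hCnabla)
      (by positivity) hε0 hκ0 hcard hεκ hA hKM hKT h4a' h4b' hy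
    exact ⟨αbar, αhat, e1, e2, IsingSim.norm_le_sqrt_card_mul hM0.le e3 e5, e4, e5⟩
  · filter_upwards [hlog, hn.eventually_gt_atTop 0, cond2] with m hL hnm h2
    have hn' : (0 : ℝ) < n m := Nat.cast_pos.2 hnm
    have hs0 : 0 ≤ s m := Real.sqrt_nonneg _
    have hs2 : (n m : ℝ) * s m ^ 2 = Real.log (p m) := by
      rw [Real.sq_sqrt (div_pos hL hn').le, mul_div_cancel₀ _ hn'.ne']
    have hexp (c d : ℝ) : n m * (c * s m) ^ 2 / d = c ^ 2 / d * Real.log (p m) := by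
      rw [← hs2]
      ring
    refine (IsingSim.measureReal_badEvent_le hnm (hWsymm m) hCW.le h2 (α₀ m)
      (G := D * s m) (g := ε * s m) (t := T * s m) (by positivity) (by positivity)
      (by positivity)).trans ?_
    have eD : D ^ 2 / (2 * CW ^ 2) = a := by rw [hD, ha]; ring
    have eT : T ^ 2 / (2 * (CW ^ 2) ^ 2) = 2 * a := by
      rw [hT, mul_pow, mul_pow, Real.sq_sqrt ha0.le]
      field_simp
    rw [hexp, hexp, hexp, eD, eT]
    gcongr
    exact_mod_cast hK₀ m
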